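/- Let $n,m\ge 1$ be integers and $\mu>0$. On $\mathbb{C}^n$ and $\mathbb{C}^m$ let $\langle a,b\rangle=\sum_i a_i\overline{b_i}$ and $\|a\|^2=\langle a,a\rangle$. Let $$D_{n,m}=\{(z,\zeta)\in\mathbb{C}^n\times\mathbb{C}^m : \|\zeta\|^2<e^{-\mu\|z\|^2}\}.$$ Let $K_{D_{n,m}}$ be the Bergman kernel of $D_{n,m}$, i.e. the reproducing kernel of the Hilbert space of holomorphic functions on $D_{n,m}$ that are square integrable for Lebesgue measure: $\overline{K_{D_{n,m}}(x,\cdot)}$ lies in this space for each $x\in D_{n,m}$, and $f(x)=\int_{D_{n,m}}f(y)K_{D_{n,m}}(x,y)\,dy$ for every $f$ in it. Let $Li_s(t)=\sum_{k=1}^\infty k^{-s}t^k$ for $|t|<1$. Then the Bergman kernel exists, and for all $(z,\zeta),(z',\zeta')\in D_{n,m}$, $$K_{D_{n,m}}((z,\zeta),(z',\zeta'))=\frac{\mu^n}{\pi^{n+m}}\,e^{m\mu\langle z,z'\rangle}\,\frac{d^m}{dt^m}Li_{-n}(t)\Big|_{t=e^{\mu\langle z,z'\rangle}\langle\zeta,\zeta'\rangle}$$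 $$=\frac{\mu^n}{\pi^{n+m}}\,\frac{d^{m-1}}{dt^{m-1}}\,\frac{Li_{-(n+1)}(e^{\mu\langle z,z'\rangle}t)}{t}\Big|_{t=\langle\zeta,\zeta'\rangle},$$ where in the last expression the quotient is extended holomorphically across its removable singularity at $t=0$. -/

import Mathlib

open MeasureTheory Filter Topology

noncomputable section

/-- The Bergman space `L²_a(Ω)`: holomorphic functions on the open set `Ω` that are square integrable
on `Ω` with respect to Lebesgue measure. (Functions are total; only their values on `Ω` matter.) -/
def MemBergmanSpace {E : Type*} [NormedAddCommGroup E] [NormedSpace ℂ E] [MeasureSpace E]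
    (Ω : Set E) (f : E → ℂ) : Prop :=
  DifferentiableOn ℂ f Ω ∧ MemLp f 2 (volume.restrict Ω)

/-- `K` is the Bergman kernel of `Ω`, i.e. the reproducing kernel of `L²_a(Ω)`: for every `x ∈ Ω` the
function `K_x = conj (K (x, ·))` lies in `L²_a(Ω)`, and `f x = ⟨f, K_x⟩ = ∫_Ω f(y) K(x, y) dy` for all
`f ∈ L²_a(Ω)`. These properties determine `K` on `Ω × Ω`. -/
structure IsBergmanKernel {E : Type*} [NormedAddCommGroup E] [NormedSpace ℂ E] [MeasureSpace E]
    (Ω : Set E) (K : E → E → ℂ) : Prop where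
  mem : ∀ x ∈ Ω, MemBergmanSpace Ω (fun y => starRingEnd ℂ (K x y))
  reproducing : ∀ f : E → ℂ, MemBergmanSpace Ω f → ∀ x ∈ Ω, f x = ∫ y in Ω, f y * K x y

/-- The standard Hermitian product `⟨z, w⟩ = ∑ zᵢ conj(wᵢ)` on `ℂᵏ`, linear in the first variable. -/
def herm {k : ℕ} (z w : Fin k → ℂ) : ℂ := ∑ i, z i * starRingEnd ℂ (w i)

/-- The squared Euclidean norm `‖z‖² = ∑ |zᵢ|²` on `ℂᵏ`
(the built-in norm of `Fin k → ℂ` is the supremum norm). -/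
def sqNorm {k : ℕ} (z : Fin k → ℂ) : ℝ := ∑ i, ‖z i‖ ^ 2

/-- The Hartogs domain `D_{n,m} = {(z, ζ) ∈ ℂⁿ × ℂᵐ : ‖ζ‖² < exp(-μ‖z‖²)}`. -/
def hartogsDomain (n m : ℕ) (μ : ℝ) : Set ((Fin n → ℂ) × (Fin m → ℂ)) :=
  {p | sqNorm p.2 < Real.exp (-μ * sqNorm p.1)}

/-- The polylogarithm `Li_s(z) = ∑_{k ≥ 1} k^{-s} z^k`, `|z| < 1`
(the summation index below is `k - 1`). -/
def polylog (s z : ℂ) : ℂ := ∑' k : ℕ, ((k : ℂ) + 1) ^ (-s) * z ^ (k + 1)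

/-- The function `t ↦ g(t)/t`, extended by its limit to the (removable) singularity `t = 0`. -/
def divId (g : ℂ → ℂ) : ℂ → ℂ :=
  Function.update (fun t => g t / t) 0 (limUnder (𝓝[≠] (0 : ℂ)) (fun t => g t / t))

end

/-! The domain is homogeneous enough that reproduction need only be checked on one coordinate disc.
A translation of the base lifts to an automorphism that rescales the fibres by $\exp$ of an affine
function; together with the unitary group of the fibre, these maps carry points $(0, s e)$, $|s|<1$,
to every point of the domain (`exists_liftAut_single`). The candidate kernel transforms by the
Jacobian, and the change of variables (`map_liftAut_withDensity`) reduces the claim to $(0, s e)$.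

There the kernel is a power series $\sum c_k (s\bar\zeta_e)^k$. Since the domain is complete
Reinhardt, averaging over circles turns $\int f\,\bar\zeta_e^k$ into the $k$-th Taylor coefficient
of $u\mapsto f(0,ue)$ times the moment $\int|\zeta_e|^{2k}$ (`setIntegral_mul_conj_pow`). So the
right $c_k$ is the inverse moment. Fubini over Gaussian and ball integrals gives
$c_k=\frac{\mu^n}{\pi^{n+m}}(k+m)^n\frac{(k+m)!}{k!}$ (`lintegral_hartogsDomain_norm_pow`), and
summing the Taylor series yields $f(0,se)$ (`setIntegral_mul_kernelSeries`).

The factor $(k+m)!/k!$ is what $m$ differentiations of $t^{k+m}$ produce, whence the polylogarithm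
formulas. Uniqueness of reproducing kernels transfers them to every Bergman kernel. -/

/-! ### Power series and the polylogarithm -/

/-- Termwise iterated differentiation of a power series with exponents `p j`. -/
theorem hasSum_iteratedDeriv_of_summable {a : ℕ → ℂ} {p : ℕ → ℕ} {R : ℝ}
    (h : ∀ t : ℂ, ‖t‖ < R → Summable fun j => a j * t ^ p j) (m : ℕ) :
    ∀ t : ℂ, ‖t‖ < R → HasSum (fun j => a j * (p j).descFactorial m * t ^ (p j - m))
      (iteratedDeriv m (fun t => ∑' j, a j * t ^ p j) t) := by
  induction m with
  | zero => intro t ht; simpa using (h t ht).hasSum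
  | succ m ih =>
    intro t ht
    -- On the ball of radius `r` the terms are dominated by their values at the point `r`, where
    -- summability in ℂ is absolute.
    obtain ⟨r, htr, hrR⟩ := exists_between ht
    have hr0 : 0 ≤ r := (norm_nonneg t).trans htr.le
    have hnr : ‖(r : ℂ)‖ = r := by simp [abs_of_nonneg hr0]
    have hu := (ih (r : ℂ) (by rwa [hnr])).summable.norm
    have key := Complex.hasSum_deriv_of_summable_norm
      (F := fun j t => a j * (p j).descFactorial m * t ^ (p j - m)) (U := Metric.ball (0 : ℂ) r)
      (z := t) hu
      (fun j => by fun_prop) Metric.isOpen_ball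
      (fun j w hw => by
        have hw : ‖w‖ ≤ r := by simpa using (Metric.mem_ball.1 hw).le
        simp only [norm_mul, norm_pow, hnr]
        gcongr) (by simpa using htr)
    have he : (fun w => ∑' j, a j * (p j).descFactorial m * w ^ (p j - m)) =ᶠ[𝓝 t]
        iteratedDeriv m (fun t => ∑' j, a j * t ^ p j) := by
      filter_upwards [Metric.isOpen_ball.mem_nhds
        (show t ∈ Metric.ball (0 : ℂ) R by simpa using ht)] with w hw
      exact (ih w (by simpa using hw)).tsum_eq
    rw [iteratedDeriv_succ, ← he.deriv_eq]
    convert! key using 2 with j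
    -- Truncated subtraction in the exponent is harmless: the descending factorial vanishes once the
    -- exponent is exhausted.
    simp only [deriv_const_mul_field', deriv_pow_field, Nat.descFactorial_succ, Nat.cast_mul,
      Nat.sub_sub]
    ring

/-- The moment-inverting coefficients of the Bergman kernel of the Hartogs domain. -/
noncomputable def kernelCoeff (n m : ℕ) (μ : ℝ) (k : ℕ) : ℝ :=
  μ ^ n / Real.pi ^ (n + m) * (((k + m : ℕ) : ℝ) ^ n * (k + m).descFactorial m)

/-- The generating function of `kernelCoeff`. -/
noncomputable def kernelSeries (n m : ℕ) (μ : ℝ) (t : ℂ) : ℂ :=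
  ∑' k, (kernelCoeff n m μ k : ℂ) * t ^ k

theorem polylog_neg_natCast (n : ℕ) (t : ℂ) :
    polylog (-(n : ℂ)) t = ∑' k : ℕ, ((k : ℂ) + 1) ^ n * t ^ (k + 1) := by
  refine tsum_congr fun k => ?_
  rw [neg_neg, Complex.cpow_natCast]

theorem summable_add_one_pow_mul_pow (n : ℕ) {t : ℂ} (ht : ‖t‖ < 1) :
    Summable fun k : ℕ => ((k : ℂ) + 1) ^ n * t ^ (k + 1) := by
  have h := summable_pow_mul_geometric_of_norm_lt_one n ht
  simpa using (summable_nat_add_iff (f := fun k : ℕ => (k : ℂ) ^ n * t ^ k) 1).2 h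

theorem hasSum_shift_of_eq_zero {f : ℕ → ℂ} {s : ℂ} (N : ℕ) (hf : HasSum f s)
    (h : ∀ i < N, f i = 0) : HasSum (fun k => f (k + N)) s := by
  rw [hasSum_nat_add_iff]
  rwa [Finset.sum_eq_zero (fun i hi => h i (Finset.mem_range.1 hi)), add_zero]

/-- The exponents start at 1, so `m + 1` derivatives kill exactly the first `m` terms; the sum is
reindexed past them. -/
theorem hasSum_iteratedDeriv_polylog (n m : ℕ) {t : ℂ} (ht : ‖t‖ < 1) :
    HasSum (fun k : ℕ => ((k + (m + 1) : ℕ) : ℂ) ^ n * (k + (m + 1)).descFactorial (m + 1) * t ^ k)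
      (iteratedDeriv (m + 1) (fun t : ℂ => polylog (-(n : ℂ)) t) t) := by
  simp only [polylog_neg_natCast]
  have := hasSum_shift_of_eq_zero m (hasSum_iteratedDeriv_of_summable
    (fun t ht => summable_add_one_pow_mul_pow n ht) (m + 1) t ht) (fun i hi => by
      rw [Nat.descFactorial_eq_zero_iff_lt.2 (by omega)]; simp)
  convert this using 2 with k
  rw [show k + m + 1 - (m + 1) = k by omega]
  push_cast
  simp only [add_assoc]

theorem hasSum_kernelSeries (n : ℕ) {m : ℕ} (hm : 1 ≤ m) (μ : ℝ) {t : ℂ} (ht : ‖t‖ < 1) :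
    HasSum (fun k => (kernelCoeff n m μ k : ℂ) * t ^ k) (kernelSeries n m μ t) := by
  obtain ⟨m, rfl⟩ := Nat.exists_eq_add_of_le' hm
  refine Summable.hasSum ?_
  have := ((hasSum_iteratedDeriv_polylog n m ht).mul_left
    ((μ : ℂ) ^ n / (Real.pi : ℂ) ^ (n + (m + 1)))).summable
  refine this.congr fun k => ?_
  simp only [kernelCoeff]
  push_cast
  ring

theorem kernelSeries_eq_iteratedDeriv_polylog (n : ℕ) {m : ℕ} (hm : 1 ≤ m) (μ : ℝ) {t : ℂ}
    (ht : ‖t‖ < 1) :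
    kernelSeries n m μ t = (μ : ℂ) ^ n / (Real.pi : ℂ) ^ (n + m) *
      iteratedDeriv m (fun t : ℂ => polylog (-(n : ℂ)) t) t := by
  obtain ⟨m, rfl⟩ := Nat.exists_eq_add_of_le' hm
  refine ((hasSum_kernelSeries n hm μ ht).unique ?_)
  convert! (hasSum_iteratedDeriv_polylog n m ht).mul_left
    ((μ : ℂ) ^ n / (Real.pi : ℂ) ^ (n + (m + 1))) using 2 with k
  simp only [kernelCoeff]
  push_cast
  ring

theorem differentiableOn_tsum_mul_pow {a : ℕ → ℂ} {R : ℝ}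
    (h : ∀ t : ℂ, ‖t‖ < R → Summable fun j => a j * t ^ j) :
    DifferentiableOn ℂ (fun t => ∑' j, a j * t ^ j) (Metric.ball 0 R) := by
  intro t ht
  obtain ⟨r, htr, hrR⟩ := exists_between (mem_ball_zero_iff.1 ht)
  have hnr : ‖(r : ℂ)‖ = r := by simp [abs_of_nonneg ((norm_nonneg t).trans htr.le)]
  have hd := Complex.differentiableOn_tsum_of_summable_norm
    (F := fun j t => a j * t ^ j) (U := Metric.ball (0 : ℂ) r)
    (h (r : ℂ) (by rwa [hnr])).norm (fun j => by fun_prop) Metric.isOpen_ball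
    (fun j w hw => by
      have hw : ‖w‖ ≤ r := by simpa using (Metric.mem_ball.1 hw).le
      simp only [norm_mul, norm_pow, hnr]
      gcongr)
  exact (hd.differentiableAt
    (Metric.isOpen_ball.mem_nhds (by simpa using htr))).differentiableWithinAt

/-- Away from 0 this is division; at 0 the limit in `divId` is found from continuity of the sum. -/
theorem divId_eq_tsum {a : ℕ → ℂ} {R : ℝ} (hR : 0 < R)
    (h : ∀ t : ℂ, ‖t‖ < R → Summable fun j => a j * t ^ j) {g : ℂ → ℂ}
    (hg : ∀ t : ℂ, ‖t‖ < R → g t = t * ∑' j, a j * t ^ j) {t : ℂ} (ht : ‖t‖ < R) :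
    divId g t = ∑' j, a j * t ^ j := by
  have hne : ∀ w : ℂ, ‖w‖ < R → w ≠ 0 → g w / w = ∑' j, a j * w ^ j := fun w hw hw0 => by
    rw [hg w hw, mul_div_cancel_left₀ _ hw0]
  by_cases h0 : t = 0
  · subst h0
    simp only [divId, Function.update_self]
    apply Tendsto.limUnder_eq
    have hcont : ContinuousAt (fun w : ℂ => ∑' j, a j * w ^ j) 0 :=
      ((differentiableOn_tsum_mul_pow h).differentiableAt
        (Metric.isOpen_ball.mem_nhds (by simpa using hR))).continuousAt
    refine (hcont.tendsto.mono_left nhdsWithin_le_nhds).congr' ?_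
    filter_upwards [self_mem_nhdsWithin, mem_nhdsWithin_of_mem_nhds
      (Metric.isOpen_ball.mem_nhds (show (0 : ℂ) ∈ Metric.ball (0 : ℂ) R by simpa using hR))]
      with w hw hwR
    exact (hne w (by simpa using hwR) hw).symm
  · rw [divId, Function.update_of_ne h0, hne t ht h0]

/-- The quotient is $\sum_j (j+1)^{n+1}e^{j+1}t^j$. One factor $j+1$ joins the $m-1$ factors
$j(j-1)\cdots$ from differentiation to form the descending factorial of $j+1$ of length $m$, leaving
$(j+1)^n$; put $j=k+m-1$. -/
theorem kernelSeries_eq_iteratedDeriv_divId (n : ℕ) {m : ℕ} (hm : 1 ≤ m) (μ : ℝ) {e t : ℂ}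
    (he : e ≠ 0) (ht : ‖e * t‖ < 1) :
    e ^ m * kernelSeries n m μ (e * t) = (μ : ℂ) ^ n / (Real.pi : ℂ) ^ (n + m) *
      iteratedDeriv (m - 1) (divId (fun t : ℂ => polylog (-((n : ℂ) + 1)) (e * t))) t := by
  obtain ⟨m, rfl⟩ := Nat.exists_eq_add_of_le' hm
  rw [Nat.add_sub_cancel]
  have he' : 0 < ‖e‖ := norm_pos_iff.2 he
  have hlt : ∀ w : ℂ, ‖w‖ < ‖e‖⁻¹ ↔ ‖e * w‖ < 1 := fun w => by
    rw [norm_mul, ← one_div, lt_div_iff₀ he', mul_comm]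
  set a : ℕ → ℂ := fun j => ((j : ℂ) + 1) ^ (n + 1) * e ^ (j + 1) with ha
  have hterm : ∀ (w : ℂ) (j : ℕ), ((j : ℂ) + 1) ^ (n + 1) * (e * w) ^ (j + 1) =
      w * (a j * w ^ j) := fun w j => by rw [ha]; ring
  have hs : ∀ w : ℂ, ‖w‖ < ‖e‖⁻¹ → Summable fun j => a j * w ^ j := fun w hw => by
    by_cases hw0 : w = 0
    · subst hw0
      exact summable_of_ne_finset_zero (s := {0}) fun j hj => by
        simp [zero_pow (by simpa using hj : j ≠ 0)]
    · refine (summable_mul_left_iff hw0).1 ?_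
      simpa only [hterm] using summable_add_one_pow_mul_pow (n + 1) ((hlt w).1 hw)
  have hdiv : divId (fun t : ℂ => polylog (-((n : ℂ) + 1)) (e * t)) =ᶠ[𝓝 t]
      fun t => ∑' j, a j * t ^ j := by
    filter_upwards [Metric.isOpen_ball.mem_nhds
      (show t ∈ Metric.ball (0 : ℂ) ‖e‖⁻¹ by simpa using (hlt t).2 ht)] with w hw
    refine divId_eq_tsum (inv_pos.2 he') hs (fun u hu => ?_) (by simpa using hw)
    have := polylog_neg_natCast (n + 1) (e * u)
    rw [Nat.cast_add, Nat.cast_one] at this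
    rw [this, ← tsum_mul_left]
    simp only [hterm]
  rw [hdiv.iteratedDeriv_eq]
  refine ((hasSum_kernelSeries n hm μ ht).mul_left _).unique ?_
  have := (hasSum_shift_of_eq_zero m (hasSum_iteratedDeriv_of_summable hs m t ((hlt t).2 ht))
    (fun i hi => by rw [Nat.descFactorial_eq_zero_iff_lt.2 hi]; simp)).mul_left
    ((μ : ℂ) ^ n / (Real.pi : ℂ) ^ (n + (m + 1)))
  convert! this using 2 with k
  simp only [kernelCoeff, ha, Nat.add_sub_cancel, ← add_assoc k m 1, Nat.succ_descFactorial_succ]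
  push_cast
  ring

/-! ### Euclidean norm and linear similarities -/

section SqNorm

variable {k : ℕ}

@[fun_prop]
theorem continuous_sqNorm : Continuous (sqNorm : (Fin k → ℂ) → ℝ) := by
  unfold sqNorm
  fun_prop

theorem sqNorm_nonneg (v : Fin k → ℂ) : 0 ≤ sqNorm v :=
  Finset.sum_nonneg fun _ _ => by positivity

theorem sqNorm_eq_zero_iff {v : Fin k → ℂ} : sqNorm v = 0 ↔ v = 0 := by
  rw [sqNorm, Finset.sum_eq_zero_iff_of_nonneg fun _ _ => by positivity]
  simp [funext_iff]

theorem sqNorm_smul (c : ℂ) (v : Fin k → ℂ) : sqNorm (c • v) = ‖c‖ ^ 2 * sqNorm v := by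
  simp [sqNorm, mul_pow, Finset.mul_sum]

theorem norm_sq_le_sqNorm (v : Fin k → ℂ) (i : Fin k) : ‖v i‖ ^ 2 ≤ sqNorm v :=
  Finset.single_le_sum (f := fun i => ‖v i‖ ^ 2) (fun _ _ => by positivity) (Finset.mem_univ i)

theorem volume_sqNorm_lt_ne_zero {R : ℝ} (hR : 0 < R) :
    volume {v : Fin k → ℂ | sqNorm v < R} ≠ 0 := by
  refine (IsOpen.measure_pos _ (isOpen_lt continuous_sqNorm continuous_const) ⟨0, ?_⟩).ne'
  simpa [sqNorm] using hR

theorem volume_sqNorm_lt_ne_top (R : ℝ) : volume {v : Fin k → ℂ | sqNorm v < R} ≠ ⊤ := by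
  refine ((Metric.isBounded_iff_subset_closedBall 0).2 ⟨√R, fun v hv => ?_⟩).measure_lt_top.ne
  rw [mem_closedBall_zero_iff, pi_norm_le_iff_of_nonneg (Real.sqrt_nonneg _)]
  exact fun i => Real.le_sqrt_of_sq_le ((norm_sq_le_sqNorm v i).trans (Set.mem_ofPred.1 hv).le)

/-- A linear similarity of ratio `c` of `ℂᵏ` scales Lebesgue measure by `c ^ (2 * k)`. -/
theorem map_volume_of_sqNorm {L : (Fin k → ℂ) →ₗ[ℂ] (Fin k → ℂ)} {c : ℝ} (hc : 0 < c)
    (hL : ∀ v, sqNorm (L v) = c ^ 2 * sqNorm v) :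
    ENNReal.ofReal (c ^ (2 * k)) • Measure.map L volume = volume := by
  set L' : (Fin k → ℂ) →ₗ[ℝ] (Fin k → ℂ) := L.restrictScalars ℝ with hL'
  have hinj : Function.Injective L' := by
    refine (injective_iff_map_eq_zero L').2 fun v hv => ?_
    have h0 := hL v
    rw [show L v = 0 from hv, sqNorm_eq_zero_iff.2 rfl, eq_comm, mul_eq_zero] at h0
    exact sqNorm_eq_zero_iff.1 (h0.resolve_left (by positivity))
  have hdet : LinearMap.det L' ≠ 0 :=
    ((LinearEquiv.ofInjectiveEndo L' hinj).isUnit_det').ne_zero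
  have hmap : Measure.map L volume = ENNReal.ofReal |(LinearMap.det L')⁻¹| • volume :=
    Measure.map_linearMap_addHaar_eq_smul_addHaar volume hdet
  -- `L` and the homothety of ratio `c` pull this ball back to the same set, of finite nonzero
  -- volume, so their determinants agree in absolute value.
  set B : Set (Fin k → ℂ) := {v | sqNorm v < c ^ 2} with hB
  have h1 := Measure.addHaar_preimage_linearMap (volume : Measure (Fin k → ℂ)) hdet B
  have h2 := Measure.addHaar_preimage_smul (volume : Measure (Fin k → ℂ)) hc.ne' B
  have h3 : L' ⁻¹' B = (fun v => c • v) ⁻¹' B := by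
    ext v
    have : sqNorm (c • v) = c ^ 2 * sqNorm v := by
      rw [show c • v = (c : ℂ) • v from rfl, sqNorm_smul]; simp
    simp only [hB, Set.mem_preimage, Set.mem_ofPred_eq, hL', LinearMap.coe_restrictScalars, hL, this]
  have hfr : Module.finrank ℝ (Fin k → ℂ) = 2 * k := by
    rw [Module.finrank_pi_fintype]; simp [mul_comm]
  rw [h3, h2, hfr, ENNReal.mul_left_inj (volume_sqNorm_lt_ne_zero (by positivity))
    (volume_sqNorm_lt_ne_top _)] at h1
  rw [hmap, ← h1, smul_smul, ← ENNReal.ofReal_mul (by positivity), abs_of_pos (by positivity),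
    mul_inv_cancel₀ (by positivity), ENNReal.ofReal_one, one_smul]

theorem lintegral_comp_of_sqNorm {L : (Fin k → ℂ) →ₗ[ℂ] (Fin k → ℂ)} {c : ℝ} (hc : 0 < c)
    (hL : ∀ v, sqNorm (L v) = c ^ 2 * sqNorm v) {G : (Fin k → ℂ) → ENNReal} (hG : Measurable G) :
    ENNReal.ofReal (c ^ (2 * k)) * ∫⁻ v, G (L v) = ∫⁻ v, G v := by
  conv_rhs => rw [← map_volume_of_sqNorm hc hL]
  rw [lintegral_smul_measure, lintegral_map hG
    (LinearMap.continuous_of_finiteDimensional L).measurable, smul_eq_mul]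

end SqNorm

/-! ### Moments of the ball and of the Hartogs domain -/

section Moments

theorem lintegral_ofReal_prod {n : ℕ} {f : Fin n → ℂ → ℝ} (hf : ∀ i z, 0 ≤ f i z)
    (hi : ∀ i, Integrable (f i)) :
    ∫⁻ x : Fin n → ℂ, ENNReal.ofReal (∏ i, f i (x i)) = ENNReal.ofReal (∏ i, ∫ z, f i z) := by
  rw [← integral_fintype_prod_volume_eq_prod, ofReal_integral_eq_lintegral_ofReal]
  · exact Integrable.fintype_prod_dep hi
  · exact ae_of_all _ fun x => Finset.prod_nonneg fun i _ => hf i _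

theorem integral_norm_pow_mul_exp (k : ℕ) {b : ℝ} (hb : 0 < b) :
    ∫ z : ℂ, ‖z‖ ^ (2 * k) * Real.exp (-b * ‖z‖ ^ 2) =
      Real.pi * k.factorial / b ^ (k + 1) := by
  have := Complex.integral_rpow_mul_exp_neg_mul_rpow (p := 2) (q := (2 * k : ℕ)) (b := b)
    (by norm_num) (by have : (0 : ℝ) ≤ (2 * k : ℕ) := by positivity
                      linarith) hb
  simp only [Real.rpow_natCast, Real.rpow_two] at this
  rw [this, show ((2 * k : ℕ) + 2 : ℝ) / 2 = (k : ℝ) + 1 by push_cast; ring,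
    Real.Gamma_nat_eq_factorial,
    show -((2 * k : ℕ) + 2 : ℝ) / 2 = -((k + 1 : ℕ) : ℝ) by push_cast; ring,
    Real.rpow_neg hb.le, Real.rpow_natCast]
  field_simp

theorem integrable_norm_pow_mul_exp (k : ℕ) {b : ℝ} (hb : 0 < b) :
    Integrable fun z : ℂ => ‖z‖ ^ (2 * k) * Real.exp (-b * ‖z‖ ^ 2) := by
  -- The Bochner integral of a non-integrable function is 0, so a positive value proves
  -- integrability.
  refine Integrable.of_integral_ne_zero ?_
  rw [integral_norm_pow_mul_exp k hb]
  positivity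

theorem lintegral_exp_neg_mul_sqNorm (n : ℕ) {b : ℝ} (hb : 0 < b) :
    ∫⁻ w : Fin n → ℂ, ENNReal.ofReal (Real.exp (-b * sqNorm w)) =
      ENNReal.ofReal ((Real.pi / b) ^ n) := by
  have h := lintegral_ofReal_prod (n := n) (f := fun _ z => ‖z‖ ^ (2 * 0) * Real.exp (-b * ‖z‖ ^ 2))
    (fun _ _ => by positivity) (fun _ => integrable_norm_pow_mul_exp 0 hb)
  simp only [integral_norm_pow_mul_exp 0 hb, Finset.prod_const, Finset.card_univ,
    Fintype.card_fin] at h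
  simpa [← Real.exp_sum, sqNorm, Finset.mul_sum] using h

theorem lintegral_norm_pow_mul_exp_neg_sqNorm {m : ℕ} (i₀ : Fin m) (k : ℕ) :
    ∫⁻ v : Fin m → ℂ, ENNReal.ofReal (‖v i₀‖ ^ (2 * k) * Real.exp (-sqNorm v)) =
      ENNReal.ofReal (Real.pi ^ m * k.factorial) := by
  set e : Fin m → ℕ := fun i => if i = i₀ then k else 0 with he
  have h := lintegral_ofReal_prod (n := m)
    (f := fun i z => ‖z‖ ^ (2 * e i) * Real.exp (-1 * ‖z‖ ^ 2))
    (fun _ _ => by positivity) (fun i => integrable_norm_pow_mul_exp (e i) one_pos)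
  simp only [integral_norm_pow_mul_exp _ one_pos] at h
  convert h using 3 with v
  · rw [Finset.prod_mul_distrib, ← Real.exp_sum]
    have h1 : ∏ i, ‖v i‖ ^ (2 * e i) = ‖v i₀‖ ^ (2 * k) := by
      rw [Finset.prod_eq_single i₀ (fun i _ hi => by simp [he, hi]) (by simp)]
      simp [he]
    rw [h1]
    simp only [sqNorm, neg_mul, one_mul, Finset.sum_neg_distrib]
  · simp only [one_pow, div_one, Finset.prod_mul_distrib, Finset.prod_const, Finset.card_univ,
      Fintype.card_fin]
    congr 1
    rw [Finset.prod_eq_single i₀ (fun i _ hi => by simp [he, hi]) (by simp)]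
    simp [he]

/-- Substitute $v\mapsto\sqrt R\,v$: the volume contributes $R^m$ and the integrand $R^k$. -/
theorem lintegral_indicator_sqNorm_lt {m : ℕ} (i₀ : Fin m) (k : ℕ) {R : ℝ} (hR : 0 < R) :
    ∫⁻ v : Fin m → ℂ, {v | sqNorm v < R}.indicator (fun v => ENNReal.ofReal (‖v i₀‖ ^ (2 * k))) v =
      ENNReal.ofReal (R ^ (k + m)) * ∫⁻ v : Fin m → ℂ,
        {v | sqNorm v < 1}.indicator (fun v => ENNReal.ofReal (‖v i₀‖ ^ (2 * k))) v := by
  have hs : 0 < √R := Real.sqrt_pos.2 hR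
  have hL : ∀ v : Fin m → ℂ, sqNorm (((√R : ℂ) • LinearMap.id (R := ℂ) (M := Fin m → ℂ)) v) =
      √R ^ 2 * sqNorm v := fun v => by
    rw [LinearMap.smul_apply, sqNorm_smul]; simp
  have hmeas : Measurable ({v : Fin m → ℂ | sqNorm v < R}.indicator
      (fun v => ENNReal.ofReal (‖v i₀‖ ^ (2 * k)))) :=
    Measurable.indicator (by fun_prop) (isOpen_lt continuous_sqNorm continuous_const).measurableSet
  rw [← lintegral_comp_of_sqNorm hs hL hmeas, pow_mul, Real.sq_sqrt hR.le, pow_add,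
    ENNReal.ofReal_mul (by positivity), mul_comm (ENNReal.ofReal (R ^ k)), mul_assoc]
  congr 1
  rw [← lintegral_const_mul' _ _ ENNReal.ofReal_ne_top]
  refine lintegral_congr fun v => ?_
  simp only [Set.indicator, Set.mem_ofPred_eq, hL, Real.sq_sqrt hR.le]
  have : R * sqNorm v < R ↔ sqNorm v < 1 := by
    constructor <;> intro h <;> nlinarith
  simp only [this]
  split_ifs
  · rw [← ENNReal.ofReal_mul (by positivity)]
    congr 1
    simp only [LinearMap.smul_apply, LinearMap.id_apply, Pi.smul_apply, smul_eq_mul, norm_mul,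
      Complex.norm_real, Real.norm_eq_abs, abs_of_pos hs, mul_pow]
    rw [pow_mul (√R), Real.sq_sqrt hR.le]
  · simp

theorem lintegral_Ioi_exp_neg (s : ℝ) :
    ∫⁻ r in Set.Ioi s, ENNReal.ofReal (Real.exp (-r)) = ENNReal.ofReal (Real.exp (-s)) := by
  rw [← integral_exp_neg_Ioi s, ofReal_integral_eq_lintegral_ofReal (integrableOn_exp_neg_Ioi s)
    (ae_of_all _ fun _ => (Real.exp_pos _).le)]

theorem lintegral_Ioi_exp_neg_mul_pow (N : ℕ) :
    ∫⁻ r in Set.Ioi (0 : ℝ), ENNReal.ofReal (Real.exp (-r) * r ^ N) =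
      ENNReal.ofReal N.factorial := by
  have h := Real.GammaIntegral_convergent (s := N + 1) (by positivity)
  have h2 := Real.Gamma_eq_integral (s := N + 1) (by positivity)
  simp only [add_sub_cancel_right, Real.rpow_natCast] at h h2
  rw [← Real.Gamma_nat_eq_factorial, h2, ofReal_integral_eq_lintegral_ofReal h]
  filter_upwards [ae_restrict_mem measurableSet_Ioi] with r hr
  have : (0 : ℝ) < r := hr
  positivity

/-- The moments of the squared modulus of a coordinate over the unit ball of `ℂᵐ`. -/
theorem lintegral_indicator_sqNorm_lt_one {m : ℕ} (i₀ : Fin m) (k : ℕ) :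
    ∫⁻ v : Fin m → ℂ, {v | sqNorm v < 1}.indicator (fun v => ENNReal.ofReal (‖v i₀‖ ^ (2 * k))) v =
      ENNReal.ofReal (Real.pi ^ m * k.factorial / (k + m).factorial) := by
  set I := ∫⁻ v : Fin m → ℂ,
    {v | sqNorm v < 1}.indicator (fun v => ENNReal.ofReal (‖v i₀‖ ^ (2 * k))) v with hI
  -- Layer cake: writing $e^{-\|v\|^2}=\int_{\|v\|^2}^\infty e^{-r}\,dr$ in the Gaussian moment and
  -- swapping integrals leaves $\int_0^\infty e^{-r}r^{k+m}\,dr\cdot I$ by scaling.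
  have key : ENNReal.ofReal (Real.pi ^ m * k.factorial) =
      ENNReal.ofReal (k + m).factorial * I := by
    rw [← lintegral_norm_pow_mul_exp_neg_sqNorm i₀ k]
    have hmeas : Measurable (Function.uncurry fun (v : Fin m → ℂ) (r : ℝ) =>
        {p : (Fin m → ℂ) × ℝ | sqNorm p.1 < p.2}.indicator
          (fun p => ENNReal.ofReal (‖p.1 i₀‖ ^ (2 * k) * Real.exp (-p.2))) (v, r)) := by
      refine Measurable.indicator (by fun_prop) (isOpen_lt ?_ ?_).measurableSet <;> fun_prop
    calc
      _ = ∫⁻ v : Fin m → ℂ, ∫⁻ r in Set.Ioi (0 : ℝ),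
          {p : (Fin m → ℂ) × ℝ | sqNorm p.1 < p.2}.indicator
            (fun p => ENNReal.ofReal (‖p.1 i₀‖ ^ (2 * k) * Real.exp (-p.2))) (v, r) := by
        refine lintegral_congr fun v => ?_
        rw [ENNReal.ofReal_mul (by positivity), ← lintegral_Ioi_exp_neg,
          ← lintegral_const_mul' _ _ ENNReal.ofReal_ne_top,
          ← lintegral_indicator measurableSet_Ioi, ← lintegral_indicator measurableSet_Ioi]
        refine lintegral_congr fun r => ?_
        have := sqNorm_nonneg v
        by_cases h : sqNorm v < r
        · have h0 : 0 < r := by linarith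
          simp [Set.indicator, h, h0, ENNReal.ofReal_mul]
        · simp [Set.indicator, h]
      _ = ∫⁻ r in Set.Ioi (0 : ℝ), ∫⁻ v : Fin m → ℂ,
          {p : (Fin m → ℂ) × ℝ | sqNorm p.1 < p.2}.indicator
            (fun p => ENNReal.ofReal (‖p.1 i₀‖ ^ (2 * k) * Real.exp (-p.2))) (v, r) :=
        lintegral_lintegral_swap hmeas.aemeasurable
      _ = ∫⁻ r in Set.Ioi (0 : ℝ), ENNReal.ofReal (Real.exp (-r) * r ^ (k + m)) * I := by
        refine setLIntegral_congr_fun measurableSet_Ioi fun r hr => ?_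
        have hr : (0 : ℝ) < r := hr
        rw [ENNReal.ofReal_mul (Real.exp_pos _).le, mul_assoc, hI,
          ← lintegral_indicator_sqNorm_lt i₀ k hr,
          ← lintegral_const_mul' _ _ ENNReal.ofReal_ne_top]
        refine lintegral_congr fun v => ?_
        simp only [Set.indicator, Set.mem_ofPred_eq]
        split_ifs
        · rw [mul_comm, ENNReal.ofReal_mul (Real.exp_pos _).le]
        · simp
      _ = _ := by
        rw [lintegral_mul_const _ (by fun_prop), lintegral_Ioi_exp_neg_mul_pow]
  rw [ENNReal.ofReal_div_of_pos (by positivity), key, mul_comm, ENNReal.mul_div_cancel_right]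
  · simp [Nat.factorial_ne_zero]
  · exact ENNReal.ofReal_ne_top

theorem measurableSet_hartogsDomain (n m : ℕ) (μ : ℝ) : MeasurableSet (hartogsDomain n m μ) :=
  (isOpen_lt (by fun_prop) (by fun_prop)).measurableSet

theorem kernelCoeff_pos (n : ℕ) {m : ℕ} (hm : 1 ≤ m) {μ : ℝ} (hμ : 0 < μ) (k : ℕ) :
    0 < kernelCoeff n m μ k := by
  have h1 : 0 < (k + m).descFactorial m := Nat.descFactorial_pos.2 (by omega)
  have h2 : 0 < k + m := by omega
  unfold kernelCoeff
  positivity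

/-- The moments of the squared modulus of a fibre coordinate over the Hartogs domain. -/
theorem lintegral_hartogsDomain_norm_pow (n : ℕ) {m : ℕ} (i₀ : Fin m) {μ : ℝ} (hμ : 0 < μ)
    (k : ℕ) :
    ∫⁻ p in hartogsDomain n m μ, ENNReal.ofReal (‖p.2 i₀‖ ^ (2 * k)) =
      ENNReal.ofReal (kernelCoeff n m μ k)⁻¹ := by
  have hm : 0 < k + m := by have := i₀.pos; omega
  rw [← lintegral_indicator (measurableSet_hartogsDomain n m μ), Measure.volume_eq_prod,
    lintegral_prod _ (Measurable.indicator (by fun_prop)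
      (measurableSet_hartogsDomain n m μ)).aemeasurable]
  -- The fibre over `w` is a ball of squared radius $e^{-\mu\|w\|^2}$; its moment is a power $k+m$
  -- of this, again a Gaussian in `w`.
  have h1 : ∀ w : Fin n → ℂ, ∫⁻ v : Fin m → ℂ, (hartogsDomain n m μ).indicator
      (fun p => ENNReal.ofReal (‖p.2 i₀‖ ^ (2 * k))) (w, v) =
      ENNReal.ofReal (Real.exp (-(μ * (k + m : ℕ)) * sqNorm w)) *
        ENNReal.ofReal (Real.pi ^ m * k.factorial / (k + m).factorial) := fun w => by
    have := lintegral_indicator_sqNorm_lt i₀ k (Real.exp_pos (-μ * sqNorm w))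
    rw [← Real.exp_nat_mul, lintegral_indicator_sqNorm_lt_one] at this
    rw [show -(μ * (k + m : ℕ)) * sqNorm w = (k + m : ℕ) * (-μ * sqNorm w) by ring, ← this]
    rfl
  simp only [h1]
  rw [lintegral_mul_const _ (by fun_prop), lintegral_exp_neg_mul_sqNorm n (by positivity),
    ← ENNReal.ofReal_mul (by positivity)]
  congr 1
  have h2 : ((k + m).factorial : ℝ) = k.factorial * (k + m).descFactorial m := by
    have := Nat.factorial_mul_descFactorial (show m ≤ k + m by omega)
    rw [Nat.add_sub_cancel] at this
    exact_mod_cast this.symm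
  have h3 : ((k + m).descFactorial m : ℝ) ≠ 0 := by
    have : 0 < (k + m).descFactorial m := Nat.descFactorial_pos.2 (by omega)
    positivity
  have h4 : ((k + m : ℕ) : ℝ) ≠ 0 := by positivity
  rw [h2, kernelCoeff, div_pow, mul_pow, pow_add]
  field_simp

theorem volume_hartogsDomain_lt_top (n : ℕ) {m : ℕ} (hm : 1 ≤ m) {μ : ℝ} (hμ : 0 < μ) :
    volume (hartogsDomain n m μ) < ⊤ := by
  have := lintegral_hartogsDomain_norm_pow n (⟨0, hm⟩ : Fin m) hμ 0
  simp only [Nat.mul_zero, pow_zero, ENNReal.ofReal_one, setLIntegral_one] at this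
  rw [this]
  exact ENNReal.ofReal_lt_top

end Moments

/-! ### The Hermitian product and unitary maps -/

section Herm

variable {k : ℕ}

theorem herm_eq_inner (a b : Fin k → ℂ) :
    herm a b = inner ℂ (WithLp.toLp 2 b) (WithLp.toLp 2 a) := by
  simp [herm, PiLp.inner_apply]

theorem sqNorm_eq_norm_sq (a : Fin k → ℂ) : sqNorm a = ‖WithLp.toLp 2 a‖ ^ 2 := by
  simp [sqNorm, EuclideanSpace.norm_sq_eq]

theorem star_herm (a b : Fin k → ℂ) : starRingEnd ℂ (herm a b) = herm b a := by
  simp [herm, map_sum, mul_comm]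

theorem herm_add_left (a b c : Fin k → ℂ) : herm (a + b) c = herm a c + herm b c := by
  simp [herm, add_mul, Finset.sum_add_distrib]

theorem herm_smul_right (a b : Fin k → ℂ) (c : ℂ) : herm a (c • b) = starRingEnd ℂ c * herm a b := by
  simp only [herm, Finset.mul_sum, Pi.smul_apply, smul_eq_mul, map_mul]
  exact Finset.sum_congr rfl fun _ _ => by ring

theorem herm_self (a : Fin k → ℂ) : herm a a = sqNorm a := by
  simp [herm, sqNorm, Complex.mul_conj']

theorem herm_re_comm (a b : Fin k → ℂ) : (herm a b).re = (herm b a).re := by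
  rw [← star_herm b a, Complex.conj_re]

theorem sqNorm_add (a b : Fin k → ℂ) :
    sqNorm (a + b) = sqNorm a + 2 * (herm a b).re + sqNorm b := by
  rw [sqNorm_eq_norm_sq, sqNorm_eq_norm_sq, sqNorm_eq_norm_sq, herm_re_comm, herm_eq_inner,
    WithLp.toLp_add, norm_add_sq (𝕜 := ℂ)]
  rfl

theorem norm_herm_sq_le (a b : Fin k → ℂ) : ‖herm a b‖ ^ 2 ≤ sqNorm a * sqNorm b := by
  rw [sqNorm_eq_norm_sq, sqNorm_eq_norm_sq, herm_eq_inner, ← mul_pow, mul_comm]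
  gcongr
  exact norm_inner_le_norm _ _

@[fun_prop]
theorem differentiable_herm_left (b : Fin k → ℂ) : Differentiable ℂ fun a => herm a b := by
  unfold herm
  fun_prop

/-- A unitary map carrying a multiple of a basis vector to a given vector. -/
theorem exists_unitary_single (i₀ : Fin k) (ζ : Fin k → ℂ) {s : ℝ} (hs : 0 ≤ s)
    (hζ : sqNorm ζ = s ^ 2) :
    ∃ U : (Fin k → ℂ) →ₗ[ℂ] (Fin k → ℂ), (∀ v, sqNorm (U v) = sqNorm v) ∧
      (∀ v, herm ζ (U v) = s * starRingEnd ℂ (v i₀)) ∧ U (Pi.single i₀ (s : ℂ)) = ζ := by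
  rcases hs.eq_or_lt with rfl | hs
  · have : ζ = 0 := sqNorm_eq_zero_iff.1 (by simpa using hζ)
    subst this
    exact ⟨LinearMap.id, by simp, by simp [herm], by simp⟩
  have hnorm : ‖WithLp.toLp 2 ζ‖ = s := by
    rw [sqNorm_eq_norm_sq] at hζ
    exact (pow_left_inj₀ (norm_nonneg _) hs.le two_ne_zero).1 hζ
  have hs' : (s : ℂ) ≠ 0 := by exact_mod_cast hs.ne'
  -- Complete ζ/s to an orthonormal basis with that vector at index `i₀`; the change of basis is the
  -- desired unitary map.
  obtain ⟨b, hb⟩ := Orthonormal.exists_orthonormalBasis_extension_of_card_eq (𝕜 := ℂ)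
    (E := EuclideanSpace ℂ (Fin k)) (ι := Fin k) (by simp)
    (v := fun _ => ((s : ℂ)⁻¹) • WithLp.toLp 2 ζ) (s := {i₀}) (by
      refine ⟨fun i => ?_, fun i j hij => absurd (Subsingleton.elim i j) hij⟩
      simp [Set.domRestrict, norm_smul, hnorm, abs_of_pos hs, hs.ne'])
  have hb := hb i₀ rfl
  have hζb : WithLp.toLp 2 ζ = (s : ℂ) • b i₀ := by rw [hb, smul_inv_smul₀ hs']
  refine ⟨(WithLp.linearEquiv 2 ℂ (Fin k → ℂ)).toLinearMap ∘ₗ b.repr.symm.toLinearEquiv.toLinearMap ∘ₗ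
    (WithLp.linearEquiv 2 ℂ (Fin k → ℂ)).symm.toLinearMap, fun v => ?_, fun v => ?_, ?_⟩
  · rw [sqNorm_eq_norm_sq, sqNorm_eq_norm_sq]
    simp
  · rw [herm_eq_inner, hζb, inner_smul_right]
    simp only [LinearMap.comp_apply]
    congr 1
    change inner ℂ (b.repr.symm (WithLp.toLp 2 v)) (b i₀) = _
    rw [← b.repr.inner_map_map]
    simp [EuclideanSpace.inner_single_right]
  · have : b.repr.symm (WithLp.toLp 2 (Pi.single i₀ (s : ℂ))) = WithLp.toLp 2 ζ := by
      rw [LinearIsometryEquiv.symm_apply_eq, hζb, map_smul, b.repr_self]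
      ext i
      by_cases hi : i = i₀
      · subst hi; simp
      · simp [hi]
    change WithLp.ofLp (b.repr.symm (WithLp.toLp 2 (Pi.single i₀ (s : ℂ)))) = ζ
    rw [this]

end Herm

/-! ### Automorphisms lifting translations of the base -/

section Automorphism

variable {n m : ℕ} {μ : ℝ}

/-- The exponent in the automorphisms of the Hartogs domain that lift translations of the base. -/
noncomputable def liftExponent (μ : ℝ) (z w : Fin n → ℂ) : ℂ :=
  -(μ * herm w z + μ * sqNorm z / 2)

/-- The automorphism of the Hartogs domain lifting the translation by `z`, twisted by `U`. -/
noncomputable def liftAut (μ : ℝ) (z : Fin n → ℂ) (U : (Fin m → ℂ) →ₗ[ℂ] (Fin m → ℂ))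
    (p : (Fin n → ℂ) × (Fin m → ℂ)) : (Fin n → ℂ) × (Fin m → ℂ) :=
  (p.1 + z, Complex.exp (liftExponent μ z p.1) • U p.2)

/-- The complex Jacobian determinant of `liftAut`, up to a unimodular constant. -/
noncomputable def liftJac (m : ℕ) (μ : ℝ) (z : Fin n → ℂ) (p : (Fin n → ℂ) × (Fin m → ℂ)) : ℂ :=
  Complex.exp (m * liftExponent μ z p.1)

@[fun_prop]
theorem differentiable_liftExponent (z : Fin n → ℂ) : Differentiable ℂ (liftExponent μ z) := by
  unfold liftExponent
  fun_prop

theorem differentiable_liftAut (z : Fin n → ℂ) (U : (Fin m → ℂ) →ₗ[ℂ] (Fin m → ℂ)) :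
    Differentiable ℂ (liftAut μ z U) := by
  have hU : Differentiable ℂ U :=
    (⟨U, LinearMap.continuous_of_finiteDimensional U⟩ :
      (Fin m → ℂ) →L[ℂ] (Fin m → ℂ)).differentiable
  have h2 : Differentiable ℂ fun p : (Fin n → ℂ) × (Fin m → ℂ) => U p.2 :=
    hU.comp differentiable_snd
  have h3 : Differentiable ℂ fun p : (Fin n → ℂ) × (Fin m → ℂ) =>
      Complex.exp (liftExponent μ z p.1) :=
    ((differentiable_liftExponent z).comp differentiable_fst).cexp
  exact (differentiable_fst.add_const z).prodMk (h3.smul h2)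

theorem differentiable_liftJac (z : Fin n → ℂ) : Differentiable ℂ (liftJac m μ z) :=
  (((differentiable_liftExponent z).comp differentiable_fst).const_mul _).cexp

/-- Expanding $\|w+z\|^2$ shows that the dilation factor squared is the ratio of the squared fibre
radii at $w+z$ and $w$, so fibres go onto fibres. -/
theorem norm_exp_liftExponent_sq (z w : Fin n → ℂ) :
    ‖Complex.exp (liftExponent μ z w)‖ ^ 2 =
      Real.exp (-μ * sqNorm (w + z)) / Real.exp (-μ * sqNorm w) := by
  rw [Complex.norm_exp, ← Real.exp_nat_mul, ← Real.exp_sub, sqNorm_add]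
  congr 1
  simp [liftExponent]
  ring

theorem norm_liftJac_sq (z : Fin n → ℂ) (p : (Fin n → ℂ) × (Fin m → ℂ)) :
    ‖liftJac m μ z p‖ ^ 2 = ‖Complex.exp (liftExponent μ z p.1)‖ ^ (2 * m) := by
  rw [liftJac, Complex.exp_nat_mul, norm_pow, ← pow_mul, mul_comm]

variable {U : (Fin m → ℂ) →ₗ[ℂ] (Fin m → ℂ)}

theorem liftAut_mem_hartogsDomain (hU : ∀ v, sqNorm (U v) = sqNorm v) (z : Fin n → ℂ)
    (p : (Fin n → ℂ) × (Fin m → ℂ)) :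
    liftAut μ z U p ∈ hartogsDomain n m μ ↔ p ∈ hartogsDomain n m μ := by
  have h1 := Real.exp_pos (-μ * sqNorm (p.1 + z))
  have h2 := Real.exp_pos (-μ * sqNorm p.1)
  simp only [hartogsDomain, Set.mem_ofPred_eq, liftAut, sqNorm_smul, hU, norm_exp_liftExponent_sq]
  rw [div_mul_eq_mul_div, div_lt_iff₀ h2]
  exact mul_lt_mul_iff_right₀ h1

/-- By Fubini: for fixed `w` the fibre map is a similarity whose volume factor is $|J|^2$, and the
base is merely translated. -/
theorem lintegral_comp_liftAut (hU : ∀ v, sqNorm (U v) = sqNorm v) (z : Fin n → ℂ)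
    {G : (Fin n → ℂ) × (Fin m → ℂ) → ENNReal} (hG : Measurable G) :
    ∫⁻ p, ENNReal.ofReal (‖liftJac m μ z p‖ ^ 2) * G (liftAut μ z U p) = ∫⁻ p, G p := by
  have hA : Measurable (liftAut μ z U) := (differentiable_liftAut z U).continuous.measurable
  have hJ : Measurable (liftJac m μ z) := (differentiable_liftJac z).continuous.measurable
  rw [Measure.volume_eq_prod, lintegral_prod _ (by fun_prop), lintegral_prod _ (by fun_prop),
    ← lintegral_add_right_eq_self (fun w => ∫⁻ v, G (w, v)) z]
  refine lintegral_congr fun w => ?_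
  have hc : 0 < ‖Complex.exp (liftExponent μ z w)‖ := norm_pos_iff.2 (Complex.exp_ne_zero _)
  rw [← lintegral_comp_of_sqNorm (G := fun v => G (w + z, v)) (L := Complex.exp (liftExponent μ z w) • U) hc
    (fun v => by rw [LinearMap.smul_apply, sqNorm_smul, hU]) (by fun_prop),
    ← lintegral_const_mul' _ _ ENNReal.ofReal_ne_top]
  refine lintegral_congr fun v => ?_
  rw [norm_liftJac_sq]
  rfl

/-- Phrased as an equality of measures, the change of variables serves both integrability and
Bochner integrals. -/
theorem map_liftAut_withDensity (hU : ∀ v, sqNorm (U v) = sqNorm v) (z : Fin n → ℂ) :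
    Measure.map (liftAut μ z U) ((volume.restrict (hartogsDomain n m μ)).withDensity
      fun p => ENNReal.ofReal (‖liftJac m μ z p‖ ^ 2)) = volume.restrict (hartogsDomain n m μ) := by
  have hA : Measurable (liftAut μ z U) := (differentiable_liftAut z U).continuous.measurable
  have hJ : Measurable (liftJac m μ z) := (differentiable_liftJac z).continuous.measurable
  have hD := measurableSet_hartogsDomain n m μ
  refine Measure.ext_of_lintegral _ fun G hG => ?_
  rw [lintegral_map hG hA, lintegral_withDensity_eq_lintegral_mul _ (by fun_prop)
      (show Measurable fun p => G (liftAut μ z U p) from hG.comp hA),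
    ← lintegral_indicator hD, ← lintegral_indicator hD, ← lintegral_comp_liftAut (μ := μ) hU z
      (hG.indicator hD)]
  refine lintegral_congr fun p => ?_
  by_cases hp : p ∈ hartogsDomain n m μ
  · simp [Set.indicator, hp, liftAut_mem_hartogsDomain hU]
  · simp [Set.indicator, hp, liftAut_mem_hartogsDomain hU]

theorem aestronglyMeasurable_map_liftAut (hU : ∀ v, sqNorm (U v) = sqNorm v) (z : Fin n → ℂ)
    {β : Type*} [TopologicalSpace β] {g : (Fin n → ℂ) × (Fin m → ℂ) → β}
    (hg : AEStronglyMeasurable g (volume.restrict (hartogsDomain n m μ))) :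
    AEStronglyMeasurable g (Measure.map (liftAut μ z U)
      ((volume.restrict (hartogsDomain n m μ)).withDensity
        fun p => ENNReal.ofReal (‖liftJac m μ z p‖ ^ 2))) := by
  rwa [map_liftAut_withDensity hU z]

theorem setIntegral_comp_liftAut (hU : ∀ v, sqNorm (U v) = sqNorm v) (z : Fin n → ℂ)
    {g : (Fin n → ℂ) × (Fin m → ℂ) → ℂ}
    (hg : AEStronglyMeasurable g (volume.restrict (hartogsDomain n m μ))) :
    ∫ p in hartogsDomain n m μ, g p = ∫ p in hartogsDomain n m μ,
      ((‖liftJac m μ z p‖ ^ 2 : ℝ) : ℂ) * g (liftAut μ z U p) := by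
  have hA : Measurable (liftAut μ z U) := (differentiable_liftAut z U).continuous.measurable
  have hJ : Measurable (liftJac m μ z) := (differentiable_liftJac z).continuous.measurable
  conv_lhs => rw [← map_liftAut_withDensity hU z]
  rw [integral_map hA.aemeasurable (aestronglyMeasurable_map_liftAut hU z hg),
    integral_withDensity_eq_integral_toReal_smul (by fun_prop) (by simp)]
  refine integral_congr_ae (ae_of_all _ fun p => ?_)
  simp only []
  rw [ENNReal.toReal_ofReal (by positivity), Complex.real_smul]

theorem integrableOn_comp_liftAut_iff (hU : ∀ v, sqNorm (U v) = sqNorm v) (z : Fin n → ℂ)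
    {g : (Fin n → ℂ) × (Fin m → ℂ) → ℝ}
    (hg : AEStronglyMeasurable g (volume.restrict (hartogsDomain n m μ))) :
    IntegrableOn (fun p => ‖liftJac m μ z p‖ ^ 2 * g (liftAut μ z U p)) (hartogsDomain n m μ) ↔
      IntegrableOn g (hartogsDomain n m μ) := by
  have hA : Measurable (liftAut μ z U) := (differentiable_liftAut z U).continuous.measurable
  have hJ : Measurable (liftJac m μ z) := (differentiable_liftJac z).continuous.measurable
  conv_rhs => rw [IntegrableOn, ← map_liftAut_withDensity hU z]
  rw [integrable_map_measure (aestronglyMeasurable_map_liftAut hU z hg) hA.aemeasurable,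
    integrable_withDensity_iff_integrable_smul' (by fun_prop) (by simp), IntegrableOn]
  refine integrable_congr (ae_of_all _ fun p => ?_)
  simp only [Function.comp_apply, smul_eq_mul]
  rw [ENNReal.toReal_ofReal (by positivity)]

theorem memBergmanSpace_hartogsDomain_iff {f : (Fin n → ℂ) × (Fin m → ℂ) → ℂ} :
    MemBergmanSpace (hartogsDomain n m μ) f ↔ DifferentiableOn ℂ f (hartogsDomain n m μ) ∧
      IntegrableOn (fun p => ‖f p‖ ^ 2) (hartogsDomain n m μ) :=
  and_congr_right fun h => memLp_two_iff_integrable_sq_norm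
    (h.continuousOn.aestronglyMeasurable (measurableSet_hartogsDomain n m μ))

theorem MemBergmanSpace.comp_liftAut (hU : ∀ v, sqNorm (U v) = sqNorm v) (z : Fin n → ℂ)
    {f : (Fin n → ℂ) × (Fin m → ℂ) → ℂ} (hf : MemBergmanSpace (hartogsDomain n m μ) f) :
    MemBergmanSpace (hartogsDomain n m μ) fun p => liftJac m μ z p * f (liftAut μ z U p) := by
  rw [memBergmanSpace_hartogsDomain_iff] at hf ⊢
  refine ⟨(differentiable_liftJac z).differentiableOn.mul (hf.1.comp
    (differentiable_liftAut z U).differentiableOn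
      fun p hp => (liftAut_mem_hartogsDomain hU z p).2 hp), ?_⟩
  have := (integrableOn_comp_liftAut_iff hU z hf.2.aestronglyMeasurable).2 hf.2
  simpa only [norm_mul, mul_pow] using this

end Automorphism

/-! ### Circle averages -/

/-- Averaging over a measure-preserving circle action does not change integrals. -/
theorem integrable_circleAverage_and_integral_eq {X : Type*} [TopologicalSpace X]
    [SecondCountableTopology X] [MeasurableSpace X] [BorelSpace X] {ν : Measure X} [SFinite ν]
    {S : Set X} (hS : MeasurableSet S) {T : ℂ → X → X} (hT : Continuous (Function.uncurry T))
    (hTν : ∀ c : ℂ, ‖c‖ = 1 → MeasurePreserving (T c) (ν.restrict S) (ν.restrict S))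
    (hTS : ∀ c : ℂ, ‖c‖ = 1 → Set.MapsTo (T c) S S) {F : X → ℂ} (hF : ContinuousOn F S)
    (hFi : IntegrableOn F S ν) :
    IntegrableOn (fun p => Real.circleAverage (fun c => F (T c p)) 0 1) S ν ∧
      ∫ p in S, Real.circleAverage (fun c => F (T c p)) 0 1 ∂ν = ∫ p in S, F p ∂ν := by
  have hnorm : ∀ θ : ℝ, ‖circleMap 0 1 θ‖ = 1 := fun θ => by simp
  have hcm : Continuous (circleMap 0 1) := continuous_circleMap 0 1
  set I : Set ℝ := Set.uIoc 0 (2 * Real.pi) with hI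
  have hIm : MeasurableSet I := measurableSet_uIoc
  have hmeas : AEStronglyMeasurable (fun q : ℝ × X => F (T (circleMap 0 1 q.1) q.2))
      ((volume.restrict I).prod (ν.restrict S)) := by
    rw [Measure.prod_restrict]
    refine ContinuousOn.aestronglyMeasurable ?_ (hIm.prod hS)
    exact hF.comp (hT.comp ((hcm.comp continuous_fst).prodMk continuous_snd)).continuousOn
      fun q hq => hTS _ (hnorm _) hq.2
  -- Integrability on the product is cheap: the $L^1$ norm over `S` does not depend on the angle.
  have hint : Integrable (fun q : ℝ × X => F (T (circleMap 0 1 q.1) q.2))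
      ((volume.restrict I).prod (ν.restrict S)) := by
    rw [integrable_prod_iff hmeas]
    refine ⟨ae_of_all _ fun θ => (hTν _ (hnorm θ)).integrable_comp_of_integrable hFi, ?_⟩
    have : ∀ θ, ∫ p in S, ‖F (T (circleMap 0 1 θ) p)‖ ∂ν = ∫ p in S, ‖F p‖ ∂ν := fun θ => by
      have h := hTν _ (hnorm θ)
      rw [← integral_map (f := fun p => ‖F p‖) h.measurable.aemeasurable, h.map_eq]
      rw [h.map_eq]
      exact hFi.norm.aestronglyMeasurable
    simp only [this]
    exact integrableOn_const (by simp [hI, Set.uIoc])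
  have havg : ∀ p, Real.circleAverage (fun c => F (T c p)) 0 1 =
      (2 * Real.pi)⁻¹ • ∫ θ in I, F (T (circleMap 0 1 θ) p) := fun p => by
    rw [Real.circleAverage_def, intervalIntegral.integral_of_le Real.two_pi_pos.le, hI,
      Set.uIoc_of_le Real.two_pi_pos.le]
  simp only [havg]
  refine ⟨Integrable.fun_smul _ hint.integral_prod_right, ?_⟩
  rw [integral_smul, ← integral_integral_swap hint]
  have : ∀ θ, ∫ p in S, F (T (circleMap 0 1 θ) p) ∂ν = ∫ p in S, F p ∂ν := fun θ => by
    have h := hTν _ (hnorm θ)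
    rw [← integral_map h.measurable.aemeasurable, h.map_eq]
    rw [h.map_eq]
    exact hFi.aestronglyMeasurable
  simp only [this]
  rw [setIntegral_const, smul_smul, measureReal_def, hI, Set.uIoc_of_le Real.two_pi_pos.le,
    Real.volume_Ioc, sub_zero, ENNReal.toReal_ofReal Real.two_pi_pos.le,
    inv_mul_cancel₀ Real.two_pi_pos.ne', one_smul]

/-- Circle averages against conjugate monomials extract Taylor coefficients. -/
theorem circleAverage_comp_mul_conj_pow {h : ℂ → ℂ} (hh : DifferentiableOn ℂ h (Metric.ball 0 1))
    {u : ℂ} (hu : ‖u‖ < 1) (k : ℕ) :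
    Real.circleAverage (fun c => h (c * u) * starRingEnd ℂ (c * u) ^ k) 0 1 =
      ((k.factorial : ℂ)⁻¹ * iteratedDeriv k h 0) * (‖u‖ ^ (2 * k) : ℝ) := by
  have hd : DifferentiableOn ℂ (fun c => h (u * c)) (Metric.closedBall 0 1) := by
    refine hh.comp (by fun_prop) fun c hc => ?_
    simp only [mem_closedBall_zero_iff, mem_ball_zero_iff, norm_mul] at hc ⊢
    nlinarith [norm_nonneg u, norm_nonneg c]
  have hder : iteratedDeriv k (fun c => h (u * c)) 0 = u ^ k * iteratedDeriv k h 0 := by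
    have h0 : (0 : ℂ) ∈ Metric.ball (0 : ℂ) 1 := by simp
    have hopen : IsOpen (Metric.ball (0 : ℂ) 1) := Metric.isOpen_ball
    have := iteratedDerivWithin_comp_const_smul (n := k) h0 hopen.uniqueDiffOn
      (hh.contDiffOn hopen) u (fun c hc => by
        simp only [mem_ball_zero_iff, norm_mul] at hc ⊢
        nlinarith [norm_nonneg u, norm_nonneg c])
    rw [iteratedDerivWithin_of_isOpen hopen h0] at this
    rw [this, mul_zero, iteratedDerivWithin_of_isOpen hopen h0, smul_eq_mul]
  have hC := hd.circleIntegral_one_div_sub_center_pow_smul one_pos k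
  rw [Real.circleAverage_eq_circleIntegral one_ne_zero]
  -- On the unit circle $\bar z=z^{-1}$, so the average becomes Cauchy's integral for the `k`-th
  -- derivative of $c\mapsto h(uc)$ at 0.
  have hcongr : (∮ z in C(0, 1), (z - 0)⁻¹ • (h (z * u) * starRingEnd ℂ (z * u) ^ k)) =
      ∮ z in C(0, 1), starRingEnd ℂ u ^ k • ((1 / (z - 0) ^ (k + 1)) • h (u * z)) := by
    refine circleIntegral.integral_congr zero_le_one fun z hz => ?_
    have hz1 : ‖z‖ = 1 := by simpa using hz
    have hconj : starRingEnd ℂ z = z⁻¹ := by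
      rw [Complex.inv_def, Complex.normSq_eq_norm_sq, hz1]; simp
    simp only [sub_zero, smul_eq_mul, map_mul, hconj, mul_comm z u]
    ring
  rw [hcongr, circleIntegral.integral_smul, hC, hder]
  have hpi : (Real.pi : ℂ) ≠ 0 := by exact_mod_cast Real.pi_ne_zero
  have huu : starRingEnd ℂ u ^ k * u ^ k = (‖u‖ ^ (2 * k) : ℝ) := by
    rw [← mul_pow, Complex.conj_mul', pow_mul]
    push_cast
    rfl
  rw [← huu]
  simp only [smul_eq_mul]
  field_simp

/-! ### Torus action and reproduction on a coordinate disc -/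

section Action

variable {n m : ℕ} {μ : ℝ}

/-- The diagonal linear map with given coefficients. -/
noncomputable def diagMap {k : ℕ} (u : Fin k → ℂ) : (Fin k → ℂ) →ₗ[ℂ] (Fin k → ℂ) :=
  LinearMap.pi fun i => u i • LinearMap.proj i

theorem diagMap_apply {k : ℕ} (u v : Fin k → ℂ) (i : Fin k) : diagMap u v i = u i * v i := rfl

theorem sqNorm_diagMap {k : ℕ} {u : Fin k → ℂ} (hu : ∀ i, ‖u i‖ = 1) (v : Fin k → ℂ) :
    sqNorm (diagMap u v) = sqNorm v := by
  simp [sqNorm, diagMap_apply, hu]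

theorem measurePreserving_of_sqNorm {k : ℕ} {L : (Fin k → ℂ) →ₗ[ℂ] (Fin k → ℂ)}
    (hL : ∀ v, sqNorm (L v) = sqNorm v) : MeasurePreserving L volume volume :=
  ⟨(LinearMap.continuous_of_finiteDimensional L).measurable, by
    simpa using map_volume_of_sqNorm (L := L) one_pos (by simpa using hL)⟩

theorem measurePreserving_prodMap_hartogsDomain {L : (Fin n → ℂ) →ₗ[ℂ] (Fin n → ℂ)}
    {M : (Fin m → ℂ) →ₗ[ℂ] (Fin m → ℂ)} (hL : ∀ v, sqNorm (L v) = sqNorm v)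
    (hM : ∀ v, sqNorm (M v) = sqNorm v) :
    MeasurePreserving (Prod.map L M) (volume.restrict (hartogsDomain n m μ))
      (volume.restrict (hartogsDomain n m μ)) := by
  have h := ((measurePreserving_of_sqNorm hL).prod
    (measurePreserving_of_sqNorm hM)).restrict_preimage (measurableSet_hartogsDomain n m μ)
  have hpre : Prod.map L M ⁻¹' hartogsDomain n m μ = hartogsDomain n m μ := by
    ext p
    simp [hartogsDomain, hL, hM]
  rwa [hpre] at h

theorem integrable_circleAverage_hartogsDomain {u : ℂ → Fin n → ℂ} {v : ℂ → Fin m → ℂ}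
    (huc : Continuous u) (hvc : Continuous v) (hu : ∀ c : ℂ, ‖c‖ = 1 → ∀ i, ‖u c i‖ = 1)
    (hv : ∀ c : ℂ, ‖c‖ = 1 → ∀ i, ‖v c i‖ = 1) {F : (Fin n → ℂ) × (Fin m → ℂ) → ℂ}
    (hF : ContinuousOn F (hartogsDomain n m μ)) (hFi : IntegrableOn F (hartogsDomain n m μ)) :
    IntegrableOn (fun p => Real.circleAverage
        (fun c => F (diagMap (u c) p.1, diagMap (v c) p.2)) 0 1) (hartogsDomain n m μ) ∧
      ∫ p in hartogsDomain n m μ, Real.circleAverage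
        (fun c => F (diagMap (u c) p.1, diagMap (v c) p.2)) 0 1 =
        ∫ p in hartogsDomain n m μ, F p := by
  refine integrable_circleAverage_and_integral_eq (measurableSet_hartogsDomain n m μ)
    (T := fun c p => (diagMap (u c) p.1, diagMap (v c) p.2)) ?_ (fun c hc => ?_)
    (fun c hc p hp => ?_) hF hFi
  · refine Continuous.prodMk (continuous_pi fun i => ?_) (continuous_pi fun i => ?_) <;>
    · simp only [diagMap_apply]
      fun_prop
  · exact measurePreserving_prodMap_hartogsDomain (sqNorm_diagMap (hu c hc))
      (sqNorm_diagMap (hv c hc))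
  · simpa [hartogsDomain, sqNorm_diagMap (hu c hc), sqNorm_diagMap (hv c hc)] using hp

theorem norm_lt_one_of_mem_hartogsDomain (hμ : 0 < μ) {p : (Fin n → ℂ) × (Fin m → ℂ)}
    (hp : p ∈ hartogsDomain n m μ) (i : Fin m) : ‖p.2 i‖ < 1 := by
  have h1 := norm_sq_le_sqNorm p.2 i
  have h2 : sqNorm p.2 < Real.exp (-μ * sqNorm p.1) := hp
  have h3 : Real.exp (-μ * sqNorm p.1) ≤ 1 :=
    Real.exp_le_one_iff.2 (by have := sqNorm_nonneg p.1; nlinarith)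
  nlinarith [norm_nonneg (p.2 i)]

theorem mem_hartogsDomain_of_norm_le (hμ : 0 < μ) {p q : (Fin n → ℂ) × (Fin m → ℂ)}
    (hp : p ∈ hartogsDomain n m μ) (h1 : ∀ i, ‖q.1 i‖ ≤ ‖p.1 i‖) (h2 : ∀ i, ‖q.2 i‖ ≤ ‖p.2 i‖) :
    q ∈ hartogsDomain n m μ := by
  have h1' : sqNorm q.1 ≤ sqNorm p.1 := Finset.sum_le_sum fun i _ => by gcongr; exact h1 i
  have h2' : sqNorm q.2 ≤ sqNorm p.2 := Finset.sum_le_sum fun i _ => by gcongr; exact h2 i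
  have hp' : sqNorm p.2 < Real.exp (-μ * sqNorm p.1) := hp
  refine h2'.trans_lt (hp'.trans_le (Real.exp_le_exp.2 ?_))
  nlinarith

theorem single_mem_hartogsDomain (i₀ : Fin m) {u : ℂ} (hu : ‖u‖ < 1) :
    ((0 : Fin n → ℂ), (Pi.single i₀ u : Fin m → ℂ)) ∈ hartogsDomain n m μ := by
  have h1 : sqNorm (Pi.single i₀ u : Fin m → ℂ) = ‖u‖ ^ 2 := by
    rw [sqNorm, Finset.sum_eq_single i₀ (fun i _ hi => by simp [hi]) (by simp)]
    simp
  have h2 : sqNorm (0 : Fin n → ℂ) = 0 := sqNorm_eq_zero_iff.2 rfl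
  simp only [hartogsDomain, Set.mem_ofPred_eq, h1, h2, mul_zero, Real.exp_zero]
  nlinarith [norm_nonneg u]

theorem integrableOn_mul_conj_pow (hμ : 0 < μ) (i₀ : Fin m)
    {f : (Fin n → ℂ) × (Fin m → ℂ) → ℂ} (hfi : IntegrableOn f (hartogsDomain n m μ)) (k : ℕ) :
    IntegrableOn (fun p => f p * starRingEnd ℂ (p.2 i₀) ^ k) (hartogsDomain n m μ) := by
  refine Integrable.mul_bdd (c := 1) hfi (by fun_prop) ?_
  filter_upwards [ae_restrict_mem (measurableSet_hartogsDomain n m μ)] with p hp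
  rw [norm_pow, RCLike.norm_conj]
  exact pow_le_one₀ (norm_nonneg _) (norm_lt_one_of_mem_hartogsDomain hμ hp i₀).le

/-- Restricting to the coordinate disc `{(0, u e)}` does not change integrals against conjugate
powers of that coordinate. -/
theorem setIntegral_mul_conj_pow_eq_single (hμ : 0 < μ) (i₀ : Fin m)
    {f : (Fin n → ℂ) × (Fin m → ℂ) → ℂ} (hf : DifferentiableOn ℂ f (hartogsDomain n m μ))
    (hfi : IntegrableOn f (hartogsDomain n m μ)) (k : ℕ) :
    IntegrableOn (fun p => f (0, Pi.single i₀ (p.2 i₀)) * starRingEnd ℂ (p.2 i₀) ^ k)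
        (hartogsDomain n m μ) ∧
      ∫ p in hartogsDomain n m μ, f (0, Pi.single i₀ (p.2 i₀)) * starRingEnd ℂ (p.2 i₀) ^ k =
        ∫ p in hartogsDomain n m μ, f p * starRingEnd ℂ (p.2 i₀) ^ k := by
  have hD := measurableSet_hartogsDomain n m μ
  -- Scale every coordinate except ζ at `i₀` by `c`. The conjugate factor stays constant, so the
  -- integrand is holomorphic in `c` on the closed disc and its circle average is the value at `c =
  -- 0`.
  have havg : ∀ p ∈ hartogsDomain n m μ, Real.circleAverage (fun c : ℂ =>
      (fun q : (Fin n → ℂ) × (Fin m → ℂ) => f q * starRingEnd ℂ (q.2 i₀) ^ k)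
        (diagMap (fun _ => c) p.1, diagMap (fun i => if i = i₀ then 1 else c) p.2)) 0 1 =
      f (0, Pi.single i₀ (p.2 i₀)) * starRingEnd ℂ (p.2 i₀) ^ k := by
    intro p hp
    have hmaps : Set.MapsTo (fun c : ℂ => (diagMap (fun _ => c) p.1,
        diagMap (fun i => if i = i₀ then 1 else c) p.2)) (Metric.closedBall 0 1)
        (hartogsDomain n m μ) := by
      intro c hc
      have hc : ‖c‖ ≤ 1 := by simpa using hc
      refine mem_hartogsDomain_of_norm_le hμ hp (fun i => ?_) (fun i => ?_)
      · simp only [diagMap_apply, norm_mul]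
        exact mul_le_of_le_one_left (norm_nonneg _) hc
      · simp only [diagMap_apply, norm_mul]
        refine mul_le_of_le_one_left (norm_nonneg _) ?_
        split_ifs <;> simp [hc]
    have hl : Differentiable ℂ (fun c : ℂ => (diagMap (fun _ => c) p.1,
        diagMap (fun i => if i = i₀ then 1 else c) p.2)) := by
      refine Differentiable.prodMk (differentiable_pi.2 fun i => ?_)
        (differentiable_pi.2 fun i => ?_)
      · simp only [diagMap_apply]; fun_prop
      · simp only [diagMap_apply]; split_ifs <;> fun_prop
    have hd : DifferentiableOn ℂ (fun c : ℂ => f (diagMap (fun _ => c) p.1,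
        diagMap (fun i => if i = i₀ then 1 else c) p.2) * starRingEnd ℂ (p.2 i₀) ^ k)
        (Metric.closedBall 0 1) :=
      (hf.comp hl.differentiableOn hmaps).mul_const _
    have hdc : DiffContOnCl ℂ (fun c : ℂ => f (diagMap (fun _ => c) p.1,
        diagMap (fun i => if i = i₀ then 1 else c) p.2) * starRingEnd ℂ (p.2 i₀) ^ k)
        (Metric.ball 0 |1|) :=
      (hd.mono (by simpa using Metric.closure_ball_subset_closedBall)).diffContOnCl
    have hmv := hdc.circleAverage
    simp only [diagMap_apply, if_true, one_mul]
    rw [hmv]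
    congr 3
    · ext i; simp [diagMap_apply]
    · ext i
      by_cases hi : i = i₀
      · subst hi; simp [diagMap_apply]
      · simp [diagMap_apply, hi]
  have key := integrable_circleAverage_hartogsDomain (μ := μ) (n := n) (m := m)
    (u := fun c _ => c) (v := fun c i => if i = i₀ then 1 else c) (by fun_prop)
    (continuous_pi fun i => by split_ifs <;> fun_prop) (fun c hc i => hc)
    (fun c hc i => by split_ifs <;> simp [hc])
    (F := fun q => f q * starRingEnd ℂ (q.2 i₀) ^ k)
    (hf.continuousOn.mul (by fun_prop)) (integrableOn_mul_conj_pow hμ i₀ hfi k)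
  refine ⟨key.1.congr_fun havg hD, ?_⟩
  rw [← key.2]
  exact (setIntegral_congr_fun hD havg).symm

theorem setIntegral_norm_pow_hartogsDomain (hμ : 0 < μ) (i₀ : Fin m) (k : ℕ) :
    ∫ p in hartogsDomain n m μ, ‖p.2 i₀‖ ^ (2 * k) = (kernelCoeff n m μ k)⁻¹ := by
  rw [integral_eq_lintegral_of_nonneg_ae (ae_of_all _ fun _ => by positivity) (by fun_prop),
    lintegral_hartogsDomain_norm_pow n i₀ hμ, ENNReal.toReal_ofReal]
  exact (inv_pos.2 (kernelCoeff_pos n i₀.pos hμ k)).le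

theorem differentiableOn_comp_single (i₀ : Fin m) {f : (Fin n → ℂ) × (Fin m → ℂ) → ℂ}
    (hf : DifferentiableOn ℂ f (hartogsDomain n m μ)) :
    DifferentiableOn ℂ (fun u : ℂ => f (0, Pi.single i₀ u)) (Metric.ball 0 1) := by
  refine hf.comp (Differentiable.differentiableOn ?_) fun u hu =>
    single_mem_hartogsDomain i₀ (by simpa using hu)
  refine (differentiable_const _).prodMk (differentiable_pi.2 fun i => ?_)
  by_cases hi : i = i₀
  · subst hi; simp
  · simp [hi]

/-- After reduction to the disc, a second average, now rotating all coordinates, isolates the `k`-th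
Taylor coefficient; what remains is the moment. -/
theorem setIntegral_mul_conj_pow (hμ : 0 < μ) (i₀ : Fin m)
    {f : (Fin n → ℂ) × (Fin m → ℂ) → ℂ} (hf : DifferentiableOn ℂ f (hartogsDomain n m μ))
    (hfi : IntegrableOn f (hartogsDomain n m μ)) (k : ℕ) :
    ∫ p in hartogsDomain n m μ, f p * starRingEnd ℂ (p.2 i₀) ^ k =
      ((k.factorial : ℂ)⁻¹ * iteratedDeriv k (fun u : ℂ => f (0, Pi.single i₀ u)) 0) *
        (kernelCoeff n m μ k : ℂ)⁻¹ := by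
  have hD := measurableSet_hartogsDomain n m μ
  obtain ⟨hi, he⟩ := setIntegral_mul_conj_pow_eq_single hμ i₀ hf hfi k
  have hd := differentiableOn_comp_single i₀ hf
  have hcont : ContinuousOn (fun p : (Fin n → ℂ) × (Fin m → ℂ) =>
      f (0, Pi.single i₀ (p.2 i₀)) * starRingEnd ℂ (p.2 i₀) ^ k) (hartogsDomain n m μ) := by
    refine ContinuousOn.mul ?_ (by fun_prop)
    exact hd.continuousOn.comp (f := fun p : (Fin n → ℂ) × (Fin m → ℂ) => p.2 i₀) (by fun_prop)
      fun p hp => by simpa using norm_lt_one_of_mem_hartogsDomain hμ hp i₀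
  have key := (integrable_circleAverage_hartogsDomain (μ := μ) (n := n) (m := m)
    (u := fun c _ => c) (v := fun c _ => c) (by fun_prop) (by fun_prop) (fun c hc _ => hc)
    (fun c hc _ => hc) hcont hi).2
  rw [← he, ← key]
  have hcongr : ∀ p ∈ hartogsDomain n m μ, Real.circleAverage (fun c : ℂ =>
      (fun q : (Fin n → ℂ) × (Fin m → ℂ) =>
        f (0, Pi.single i₀ (q.2 i₀)) * starRingEnd ℂ (q.2 i₀) ^ k)
        (diagMap (fun _ => c) p.1, diagMap (fun _ => c) p.2)) 0 1 =
      ((k.factorial : ℂ)⁻¹ * iteratedDeriv k (fun u : ℂ => f (0, Pi.single i₀ u)) 0) *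
        (‖p.2 i₀‖ ^ (2 * k) : ℝ) := fun p hp =>
    circleAverage_comp_mul_conj_pow hd (norm_lt_one_of_mem_hartogsDomain hμ hp i₀) k
  rw [setIntegral_congr_fun hD hcongr, integral_const_mul, integral_complex_ofReal,
    setIntegral_norm_pow_hartogsDomain hμ, Complex.ofReal_inv]

/-- The reproducing property at the points of a coordinate disc. -/
theorem setIntegral_mul_kernelSeries (hμ : 0 < μ) (i₀ : Fin m)
    {f : (Fin n → ℂ) × (Fin m → ℂ) → ℂ} (hf : DifferentiableOn ℂ f (hartogsDomain n m μ))
    (hfi : IntegrableOn f (hartogsDomain n m μ)) {s : ℂ} (hs : ‖s‖ < 1) :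
    ∫ p in hartogsDomain n m μ, f p * kernelSeries n m μ (s * starRingEnd ℂ (p.2 i₀)) =
      f (0, Pi.single i₀ s) := by
  have hD := measurableSet_hartogsDomain n m μ
  have hm : 1 ≤ m := i₀.pos
  have hd := differentiableOn_comp_single i₀ hf
  have htaylor := Complex.hasSum_taylorSeries_on_ball hd (z := s) (by simpa using hs)
  -- Sum and integral commute: since $|\zeta_{i_0}|<1$, the `k`-th term has $L^1$ norm at most
  -- $c_k|s|^k\|f\|_{L^1}$.
  have hsum := hasSum_integral_of_summable_integral_norm
    (μ := volume.restrict (hartogsDomain n m μ))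
    (F := fun k p => (kernelCoeff n m μ k * s ^ k) * (f p * starRingEnd ℂ (p.2 i₀) ^ k))
    (fun k => (integrableOn_mul_conj_pow hμ i₀ hfi k).const_mul _) (by
      refine Summable.of_nonneg_of_le (fun k => integral_nonneg fun p => norm_nonneg _)
        (fun k => ?_) ((hasSum_kernelSeries n hm μ hs).summable.norm.mul_right
          (∫ p in hartogsDomain n m μ, ‖f p‖))
      simp only [norm_mul]
      rw [integral_const_mul]
      refine mul_le_mul_of_nonneg_left ?_ (by positivity)
      refine setIntegral_mono_on ?_ hfi.norm hD fun p hp => ?_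
      · exact (integrableOn_mul_conj_pow hμ i₀ hfi k).norm.congr (ae_of_all _ fun p => norm_mul _ _)
      · rw [norm_pow, RCLike.norm_conj]
        exact mul_le_of_le_one_right (norm_nonneg _)
          (pow_le_one₀ (norm_nonneg _) (norm_lt_one_of_mem_hartogsDomain hμ hp i₀).le))
  have hL : ∫ p in hartogsDomain n m μ, f p * kernelSeries n m μ (s * starRingEnd ℂ (p.2 i₀)) =
      ∫ p in hartogsDomain n m μ,
        ∑' k, (kernelCoeff n m μ k * s ^ k) * (f p * starRingEnd ℂ (p.2 i₀) ^ k) := by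
    refine setIntegral_congr_fun hD fun p _ => ?_
    simp only [kernelSeries]
    rw [← tsum_mul_left]
    refine tsum_congr fun k => ?_
    ring
  rw [hL]
  refine hsum.unique ?_
  convert! htaylor using 2 with k
  rw [integral_const_mul, setIntegral_mul_conj_pow hμ i₀ hf hfi]
  have : (kernelCoeff n m μ k : ℂ) ≠ 0 := by
    exact_mod_cast (kernelCoeff_pos n hm hμ k).ne'
  simp only [smul_eq_mul, sub_zero]
  field_simp

end Action

/-! ### The kernel and its reproducing property -/

section Kernel

variable {n m : ℕ} {μ : ℝ}

/-- The closed form of the Bergman kernel of the Hartogs domain, before rewriting the series. -/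
noncomputable def hartogsKernel (n m : ℕ) (μ : ℝ) (x y : (Fin n → ℂ) × (Fin m → ℂ)) : ℂ :=
  Complex.exp (m * (μ * herm x.1 y.1)) *
    kernelSeries n m μ (Complex.exp (μ * herm x.1 y.1) * herm x.2 y.2)

theorem star_hartogsKernel (x y : (Fin n → ℂ) × (Fin m → ℂ)) :
    starRingEnd ℂ (hartogsKernel n m μ x y) = hartogsKernel n m μ y x := by
  simp only [hartogsKernel, kernelSeries, map_mul, ← Complex.exp_conj, star_herm,
    Complex.conj_ofReal, Complex.conj_tsum, map_pow, map_natCast]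

theorem norm_exp_mul_herm_lt_one (hμ : 0 < μ) {x y : (Fin n → ℂ) × (Fin m → ℂ)}
    (hx : x ∈ hartogsDomain n m μ) (hy : y ∈ hartogsDomain n m μ) :
    ‖Complex.exp (μ * herm x.1 y.1) * herm x.2 y.2‖ < 1 := by
  have hx' : sqNorm x.2 < Real.exp (-μ * sqNorm x.1) := hx
  have hy' : sqNorm y.2 < Real.exp (-μ * sqNorm y.1) := hy
  refine (sq_lt_one_iff₀ (norm_nonneg _)).1 ?_
  rw [norm_mul, mul_pow, Complex.norm_exp, ← Real.exp_nat_mul]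
  -- Cauchy–Schwarz handles the fibre; this gives $2\,\mathrm{Re}\langle
  -- z,z'\rangle\le\|z\|^2+\|z'\|^2$ for the exponential.
  have hdist := sqNorm_nonneg (x.1 + (-1 : ℂ) • y.1)
  rw [sqNorm_add, sqNorm_smul, herm_smul_right] at hdist
  simp at hdist
  have hprod : sqNorm x.2 * sqNorm y.2 <
      Real.exp (-μ * sqNorm x.1) * Real.exp (-μ * sqNorm y.1) :=
    mul_lt_mul'' hx' hy' (sqNorm_nonneg _) (sqNorm_nonneg _)
  calc _ ≤ Real.exp ((2 : ℕ) * (μ * herm x.1 y.1).re) * (sqNorm x.2 * sqNorm y.2) := by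
        gcongr; exact norm_herm_sq_le _ _
    _ < Real.exp ((2 : ℕ) * (μ * herm x.1 y.1).re) *
        (Real.exp (-μ * sqNorm x.1) * Real.exp (-μ * sqNorm y.1)) := by gcongr
    _ ≤ 1 := by
      rw [← Real.exp_add, ← Real.exp_add]
      refine Real.exp_le_one_iff.2 ?_
      rw [Complex.re_ofReal_mul]
      push_cast
      nlinarith

theorem differentiableOn_kernelSeries (n : ℕ) (hm : 1 ≤ m) (μ : ℝ) :
    DifferentiableOn ℂ (kernelSeries n m μ) (Metric.ball 0 1) :=
  differentiableOn_tsum_mul_pow fun _ ht => (hasSum_kernelSeries n hm μ ht).summable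

theorem differentiableOn_hartogsKernel_left (hm : 1 ≤ m) (hμ : 0 < μ)
    {x : (Fin n → ℂ) × (Fin m → ℂ)} (hx : x ∈ hartogsDomain n m μ) :
    DifferentiableOn ℂ (fun y => hartogsKernel n m μ y x) (hartogsDomain n m μ) := by
  have h1 : Differentiable ℂ fun y : (Fin n → ℂ) × (Fin m → ℂ) => herm y.1 x.1 :=
    (differentiable_herm_left x.1).comp differentiable_fst
  have h2 : Differentiable ℂ fun y : (Fin n → ℂ) × (Fin m → ℂ) => herm y.2 x.2 :=
    (differentiable_herm_left x.2).comp differentiable_snd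
  have h3 : Differentiable ℂ fun y : (Fin n → ℂ) × (Fin m → ℂ) =>
      Complex.exp (m * (μ * herm y.1 x.1)) := ((h1.const_mul _).const_mul _).cexp
  have h4 : Differentiable ℂ fun y : (Fin n → ℂ) × (Fin m → ℂ) =>
      Complex.exp (μ * herm y.1 x.1) * herm y.2 x.2 := ((h1.const_mul _).cexp).mul h2
  exact h3.differentiableOn.mul ((differentiableOn_kernelSeries n hm μ).comp h4.differentiableOn
    fun y hy => mem_ball_zero_iff.2 (norm_exp_mul_herm_lt_one hμ hy hx))

theorem aestronglyMeasurable_hartogsKernel (hm : 1 ≤ m) (hμ : 0 < μ)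
    {x : (Fin n → ℂ) × (Fin m → ℂ)} (hx : x ∈ hartogsDomain n m μ) :
    AEStronglyMeasurable (hartogsKernel n m μ x) (volume.restrict (hartogsDomain n m μ)) := by
  have h := (Complex.continuous_conj.comp_continuousOn
    (differentiableOn_hartogsKernel_left hm hμ hx).continuousOn).aestronglyMeasurable
      (μ := volume) (measurableSet_hartogsDomain n m μ)
  exact h.congr (ae_of_all _ fun y => star_hartogsKernel y x)

/-- Every point of the Hartogs domain is the image of a point on a coordinate disc under an
automorphism, along which the kernel transforms by the Jacobian. -/
theorem exists_liftAut_single (i₀ : Fin m) {x : (Fin n → ℂ) × (Fin m → ℂ)}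
    (hx : x ∈ hartogsDomain n m μ) :
    ∃ (U : (Fin m → ℂ) →ₗ[ℂ] (Fin m → ℂ)) (s : ℂ), (∀ v, sqNorm (U v) = sqNorm v) ∧ ‖s‖ < 1 ∧
      liftAut μ x.1 U (0, Pi.single i₀ s) = x ∧
      ∀ p, starRingEnd ℂ (liftJac m μ x.1 p) * hartogsKernel n m μ x (liftAut μ x.1 U p) =
        Complex.exp (m * (μ * sqNorm x.1 / 2)) *
          kernelSeries n m μ (s * starRingEnd ℂ (p.2 i₀)) := by
  have hx' : sqNorm x.2 < Real.exp (-μ * sqNorm x.1) := hx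
  set r := √(sqNorm x.2) with hr
  have hr2 : sqNorm x.2 = r ^ 2 := (Real.sq_sqrt (sqNorm_nonneg _)).symm
  obtain ⟨U, hU, hUh, hUs⟩ := exists_unitary_single i₀ x.2 (Real.sqrt_nonneg _) hr2
  -- Over `0` the automorphism contracts fibres by $e^{-\mu\|z\|^2/2}$, which fixes `s`; then
  -- $|s|<1$ is exactly membership of `x`.
  refine ⟨U, Complex.exp (μ * sqNorm x.1 / 2) * r, hU, ?_, ?_, fun p => ?_⟩
  · refine (sq_lt_one_iff₀ (norm_nonneg _)).1 ?_
    rw [norm_mul, mul_pow, Complex.norm_exp, ← Real.exp_nat_mul, Complex.norm_real,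
      Real.norm_eq_abs, sq_abs, ← hr2]
    have : (2 : ℕ) * ((μ : ℂ) * sqNorm x.1 / 2).re = -(-μ * sqNorm x.1) := by
      rw [show (μ : ℂ) * sqNorm x.1 / 2 = ((μ * sqNorm x.1 / 2 : ℝ) : ℂ) by push_cast; ring,
        Complex.ofReal_re]
      push_cast
      ring
    rw [this, Real.exp_neg, inv_mul_lt_iff₀ (Real.exp_pos _), mul_one]
    exact hx'
  · have h1 : (Pi.single i₀ (Complex.exp (μ * sqNorm x.1 / 2) * r) : Fin m → ℂ) =
        Complex.exp (μ * sqNorm x.1 / 2) • Pi.single i₀ (r : ℂ) := by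
      rw [← Pi.single_smul, smul_eq_mul]
    have h2 : liftExponent μ x.1 0 = -(μ * sqNorm x.1 / 2) := by simp [liftExponent, herm]
    simp only [liftAut]
    rw [h1, map_smul, hUs, h2, smul_smul, ← Complex.exp_add, neg_add_cancel, Complex.exp_zero,
      one_smul, zero_add]
  · have hherm : herm x.1 (p.1 + x.1) = herm x.1 p.1 + sqNorm x.1 := by
      rw [← star_herm, herm_add_left, map_add, star_herm, star_herm, herm_self]
    have hexp : starRingEnd ℂ (liftExponent μ x.1 p.1) =
        -(μ * herm x.1 p.1 + μ * sqNorm x.1 / 2) := by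
      simp [liftExponent, star_herm, map_ofNat]
    -- The terms $\langle z,p_1\rangle$ cancel between the conjugate Jacobian and the kernel, both
    -- in the prefactor and in the argument of the series.
    simp only [liftJac, liftAut, hartogsKernel, hherm, herm_smul_right, ← Complex.exp_conj, hexp,
      hUh, map_mul, map_natCast]
    rw [← mul_assoc, ← Complex.exp_add,
      ← mul_assoc (Complex.exp (μ * (herm x.1 p.1 + sqNorm x.1))), ← Complex.exp_add,
      mul_assoc _ (r : ℂ)]
    congr 2
    · ring
    · congr 2
      ring

/-- Pulled back by the automorphism, the kernel at `x` is bounded on a domain of finite volume,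
hence square integrable. For reproduction, the disc case is applied to $J\cdot(f\circ A)$; the
constant $e^{m\mu\|z\|^2/2}$ cancels the value of $J$ at $(0,se)$. -/
theorem isBergmanKernel_hartogsKernel (n : ℕ) (hm : 1 ≤ m) (hμ : 0 < μ) :
    IsBergmanKernel (hartogsDomain n m μ) (hartogsKernel n m μ) := by
  have hD := measurableSet_hartogsDomain n m μ
  have hfin : IsFiniteMeasure (volume.restrict (hartogsDomain n m μ)) :=
    isFiniteMeasure_restrict.2 (volume_hartogsDomain_lt_top n hm hμ).ne
  set i₀ : Fin m := ⟨0, hm⟩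
  constructor
  · intro x hx
    obtain ⟨U, s, hU, hs, -, hK⟩ := exists_liftAut_single i₀ hx
    rw [memBergmanSpace_hartogsDomain_iff]
    refine ⟨?_, ?_⟩
    · simpa only [star_hartogsKernel] using differentiableOn_hartogsKernel_left hm hμ hx
    simp only [RCLike.norm_conj]
    have hmeas := aestronglyMeasurable_hartogsKernel hm hμ hx
    rw [← integrableOn_comp_liftAut_iff hU x.1
      (g := fun y => ‖hartogsKernel n m μ x y‖ ^ 2) (hmeas.norm.pow 2)]
    have hnorm : ∀ p, ‖liftJac m μ x.1 p‖ ^ 2 * ‖hartogsKernel n m μ x (liftAut μ x.1 U p)‖ ^ 2 =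
        ‖Complex.exp (m * (μ * sqNorm x.1 / 2)) *
          kernelSeries n m μ (s * starRingEnd ℂ (p.2 i₀))‖ ^ 2 := fun p => by
      rw [← hK p, norm_mul, RCLike.norm_conj, mul_pow]
    simp only [hnorm]
    have hmem : ∀ p ∈ hartogsDomain n m μ, ‖s * starRingEnd ℂ (p.2 i₀)‖ ≤ ‖s‖ := fun p hp => by
      rw [norm_mul, RCLike.norm_conj]
      exact mul_le_of_le_one_right (norm_nonneg _) (norm_lt_one_of_mem_hartogsDomain hμ hp i₀).le
    have hcont : ContinuousOn (fun p : (Fin n → ℂ) × (Fin m → ℂ) =>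
        kernelSeries n m μ (s * starRingEnd ℂ (p.2 i₀))) (hartogsDomain n m μ) :=
      (differentiableOn_kernelSeries n hm μ).continuousOn.comp
        (f := fun p : (Fin n → ℂ) × (Fin m → ℂ) => s * starRingEnd ℂ (p.2 i₀)) (by fun_prop)
        fun p hp => mem_ball_zero_iff.2 ((hmem p hp).trans_lt hs)
    -- The argument of the series stays in the compact disc of radius $|s|<1$.
    obtain ⟨C, hC⟩ := (isCompact_closedBall (0 : ℂ) ‖s‖).exists_bound_of_continuousOn
      ((differentiableOn_kernelSeries n hm μ).continuousOn.mono (Metric.closedBall_subset_ball hs))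
    refine Integrable.of_bound (C := (‖Complex.exp (m * (μ * sqNorm x.1 / 2))‖ * C) ^ 2)
      (((continuousOn_const.mul hcont).norm.pow 2).aestronglyMeasurable hD) ?_
    filter_upwards [ae_restrict_mem hD] with p hp
    rw [norm_pow, norm_norm, norm_mul]
    gcongr
    exact hC _ (by simpa using hmem p hp)
  · intro f hf x hx
    obtain ⟨U, s, hU, hs, hAs, hK⟩ := exists_liftAut_single i₀ hx
    have hF := hf.comp_liftAut hU x.1
    rw [setIntegral_comp_liftAut hU x.1 (g := fun y => f y * hartogsKernel n m μ x y)
      (hf.2.aestronglyMeasurable.mul (aestronglyMeasurable_hartogsKernel hm hμ hx))]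
    have hcongr : ∀ p, ((‖liftJac m μ x.1 p‖ ^ 2 : ℝ) : ℂ) *
        (f (liftAut μ x.1 U p) * hartogsKernel n m μ x (liftAut μ x.1 U p)) =
        Complex.exp (m * (μ * sqNorm x.1 / 2)) * ((liftJac m μ x.1 p * f (liftAut μ x.1 U p)) *
          kernelSeries n m μ (s * starRingEnd ℂ (p.2 i₀))) := fun p => by
      rw [mul_left_comm (Complex.exp _), ← hK p, Complex.ofReal_pow, ← Complex.mul_conj']
      ring
    simp only [hcongr]
    rw [integral_const_mul, setIntegral_mul_kernelSeries hμ i₀ hF.1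
      (hF.2.integrable one_le_two) hs, hAs, ← mul_assoc]
    have h2 : liftExponent μ x.1 0 = -(μ * sqNorm x.1 / 2) := by simp [liftExponent, herm]
    rw [liftJac, h2, ← Complex.exp_add, mul_neg, add_neg_cancel, Complex.exp_zero, one_mul]

end Kernel

/-! ### Uniqueness and the closed formulas -/

/-- Two Bergman kernels of the same set agree there. -/
theorem IsBergmanKernel.unique {E : Type*} [NormedAddCommGroup E] [NormedSpace ℂ E]
    [MeasureSpace E] {Ω : Set E} {K L : E → E → ℂ} (hK : IsBergmanKernel Ω K)
    (hL : IsBergmanKernel Ω L) {x y : E} (hx : x ∈ Ω) (hy : y ∈ Ω) : K x y = L x y := by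
  -- Each kernel function lies in the space, so each reproduces the other; the two integrals are
  -- conjugate. With `L = K` this is Hermitian symmetry.
  have key : ∀ {K L : E → E → ℂ}, IsBergmanKernel Ω K → IsBergmanKernel Ω L → ∀ {x y : E},
      x ∈ Ω → y ∈ Ω → L y x = starRingEnd ℂ (K x y) := by
    intro K L hK hL x y hx hy
    have h1 := hL.reproducing _ (hK.mem x hx) y hy
    have h2 := congrArg (starRingEnd ℂ) (hK.reproducing _ (hL.mem y hy) x hx)
    rw [← integral_conj] at h2
    simp only [map_mul, Complex.conj_conj] at h2
    rw [h1, h2]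
    simp only [mul_comm]
  exact (key hK hK hy hx).trans (key hK hL hy hx).symm

theorem theorem2 (n m : ℕ) (hm : 1 ≤ m) (μ : ℝ) (hμ : 0 < μ) :
    (∃ K : (Fin n → ℂ) × (Fin m → ℂ) → (Fin n → ℂ) × (Fin m → ℂ) → ℂ,
      IsBergmanKernel (hartogsDomain n m μ) K) ∧
    ∀ K : (Fin n → ℂ) × (Fin m → ℂ) → (Fin n → ℂ) × (Fin m → ℂ) → ℂ,
      IsBergmanKernel (hartogsDomain n m μ) K →
      ∀ (z : Fin n → ℂ) (ζ : Fin m → ℂ) (z' : Fin n → ℂ) (ζ' : Fin m → ℂ),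
        (z, ζ) ∈ hartogsDomain n m μ → (z', ζ') ∈ hartogsDomain n m μ →
        K (z, ζ) (z', ζ') =
            (μ : ℂ) ^ n / (Real.pi : ℂ) ^ (n + m) * Complex.exp (m * μ * herm z z') *
              iteratedDeriv m (fun t : ℂ => polylog (-(n : ℂ)) t)
                (Complex.exp (μ * herm z z') * herm ζ ζ') ∧
        K (z, ζ) (z', ζ') =
            (μ : ℂ) ^ n / (Real.pi : ℂ) ^ (n + m) *
              iteratedDeriv (m - 1)
                (divId (fun t : ℂ => polylog (-((n : ℂ) + 1)) (Complex.exp (μ * herm z z') * t)))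
                (herm ζ ζ') := by
  have hker := isBergmanKernel_hartogsKernel n hm hμ
  refine ⟨⟨_, hker⟩, fun K hK z ζ z' ζ' hx hy => ?_⟩
  have ht := norm_exp_mul_herm_lt_one hμ hx hy
  rw [hK.unique hker hx hy]
  constructor
  · rw [hartogsKernel, kernelSeries_eq_iteratedDeriv_polylog n hm μ ht, mul_assoc (m : ℂ)]
    ring
  · rw [← kernelSeries_eq_iteratedDeriv_divId n hm μ (Complex.exp_ne_zero _) ht, hartogsKernel,
      Complex.exp_nat_mul]
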